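/- **Setting.** Processes $p_1,\dots,p_n$ communicate asynchronously through shared memory by atomic read, write and compare-and-swap (CAS) primitives; each field of each list node is a separate base object. A node has the fields $val\in\mathbb Z\cup\{\pm\infty\}$, $next$ (a reference to a node), $deleted$ (a boolean) and $vlock$ (a versioned lock: an unbounded natural-number counter, even when unlocked, odd when locked, supporting read and CAS). Initially there are only two nodes, $head$ and $tail$, with $head.val=-\infty$, $tail.val=+\infty$, $head.next=tail$, both undeleted and with lock value $0$. A newly allocated node has never been used before, is undeleted and has lock value $0$. *Versioned lock.* $\mathrm{getVersion}()$ reads the counter and returns it with its last bit set to $0$; $\mathrm{tryLockAtVersion}(ver)$ is $\mathrm{CAS}(ver,ver+1)$ on the counter and returns whether it succeeded; $\mathrm{lockAtCurrentVersion}()$ repeats $ver\gets\mathrm{getVersion}()$, $\mathrm{tryLockAtVersion}(ver)$ until success; $\mathrm{unlockAndIncrementVersion}()$ reads the counter value $x$ and then performs $\mathrm{CAS}(x,x+1)$. **The Versioned List algorithm**, for $v\in\mathbb Z$: - $\mathrm{contains}(v)$: $curr\gets head$; while $curr.val<v$ do $curr\gets curr.next$; return ($curr.val=v$ and not $curr.deleted$).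 - $\mathrm{waitfreeTraversal}(v)$: $prev\gets curr\gets head$; while $curr.val<v$ do ($prev\gets curr$; $curr\gets curr.next$); return $prev$. - $\mathrm{validate}(v,prev)$: (a) $pVer\gets prev.vlock.\mathrm{getVersion}()$; if $prev.deleted$, return $\bot$; $curr\gets prev.next$; while $curr.val<v$ do ($pVer\gets curr.vlock.\mathrm{getVersion}()$; if $curr.deleted$, go to (a); $prev\gets curr$; $curr\gets curr.next$); return $(prev,pVer,curr)$. - $\mathrm{insert}(v)$: (1) $prev\gets\mathrm{waitfreeTraversal}(v)$; (2) call $\mathrm{validate}(v,prev)$: if it returns $\bot$, go to (1), otherwise set $(prev,pVer,curr)$ to its result; if $curr.deleted$, go to (2); if $curr.val=v$, return false; allocate a new node $newNode$, with $newNode.val\gets v$, then $newNode.next\gets curr$; if $prev.vlock.\mathrm{tryLockAtVersion}(pVer)$ fails, go to (2); $prev.next\gets newNode$; $prev.vlock.\mathrm{unlockAndIncrementVersion}()$; return true. - $\mathrm{remove}(v)$: (1) and (2) as in $\mathrm{insert}$; then, if $curr.val\ne v$ or $curr.deleted$, return false; if $prev.vlock.\mathrm{tryLockAtVersion}(pVer)$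 fails, go to (2); $curr.vlock.\mathrm{lockAtCurrentVersion}()$; $curr.deleted\gets$ true; $prev.next\gets curr.next$; $curr.vlock.\mathrm{unlockAndIncrementVersion}()$; $prev.vlock.\mathrm{unlockAndIncrementVersion}()$; return true. An execution is a sequence of events, each an invocation of one of the operations $\mathrm{insert}(v),\mathrm{remove}(v),\mathrm{contains}(v)$ by a process that has no operation in progress, the next primitive of the operation in progress at some process, or the response of an operation; scheduling is arbitrary. Its high-level history $H$ is the subsequence of invocations and responses. **The set type.** The state is a set $q\subseteq\mathbb Z$, initially $\emptyset$. $\mathrm{insert}(v)$ changes $q$ to $q\cup\{v\}$ and returns true iff $v\notin q$; $\mathrm{remove}(v)$ changes $q$ to $q\setminus\{v\}$ and returns true iff $v\in q$; $\mathrm{contains}(v)$ leaves $q$ unchanged and returns true iff $v\in q$. **Theorem.** The Versioned List algorithm is linearizable with respect to the set type: for every number $n$ of processes and every finite execution with high-level history $H$, one can complete $H$ to a history $\tilde H$, by adding matching responses for some of the incomplete operations and removing the invocations of the other incomplete operations, so that there is a sequential history $S$ such that (i) $S$ and $\tilde H$ have the same subsequence of events at every process, (ii) if the response of an operation $\pi$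 occurs before the invocation of an operation $\pi'$ in $\tilde H$, then the same holds in $S$, and (iii) $S$ is consistent with the sequential specification of the set type. -/

import Mathlib

namespace VersionedList

/-! ### Object types, high-level histories, linearizability -/

/-- An abstract data type: states, operations (with their arguments), responses, an initial state,
and a sequential specification. `trans q op q' r` says that applying `op` in state `q` may lead to
state `q'` and return `r`. -/
structure ObjType where
  State : Type
  Op : Type
  Resp : Type
  init : State
  trans : State → Op → State → Resp → Prop

/-- The operations of the set type, with their integer argument. -/
inductive SetOp where
  | insert (v : ℤ)
  | remove (v : ℤ)
  | contains (v : ℤ)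

/-- The set type: a set of integers, initially empty. -/
def setType : ObjType where
  State := Set ℤ
  Op := SetOp
  Resp := Bool
  init := ∅
  trans := fun q op q' r =>
    match op with
    | .insert v => q' = q ∪ {v} ∧ (r = true ↔ v ∉ q)
    | .remove v => q' = q \ {v} ∧ (r = true ↔ v ∈ q)
    | .contains v => q' = q ∧ (r = true ↔ v ∈ q)

/-- Events of a high-level history: invocations and responses of operations by processes in `P`. -/
inductive HEvent (P Op Resp : Type) where
  | inv (p : P) (op : Op)
  | res (p : P) (r : Resp)

section Histories

variable {P Op Resp : Type} [DecidableEq P]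

/-- The event is an invocation by process `p`. -/
def HEvent.isInvOf (p : P) : HEvent P Op Resp → Bool
  | .inv q _ => decide (q = p)
  | .res _ _ => false

/-- The event is a response to process `p`. -/
def HEvent.isResOf (p : P) : HEvent P Op Resp → Bool
  | .inv _ _ => false
  | .res q _ => decide (q = p)

/-- The subsequence of the events of process `p`. -/
def proj (p : P) (H : List (HEvent P Op Resp)) : List (HEvent P Op Resp) :=
  H.filter fun e => e.isInvOf p || e.isResOf p

/-- Two histories are equivalent if every process has the same events, in the same order,
in both. -/
def Equivalent (H H' : List (HEvent P Op Resp)) : Prop :=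
  ∀ p : P, proj p H = proj p H'

/-- The list alternates invocations and responses, starting with an invocation. -/
def Alternates : List (HEvent P Op Resp) → Prop
  | [] => True
  | [.inv _ _] => True
  | .inv _ _ :: .res _ _ :: t => Alternates t
  | _ => False

/-- A history is well-formed if no process invokes an operation before its previous operation has
returned, and every response answers an invocation. -/
def WellFormed (H : List (HEvent P Op Resp)) : Prop :=
  ∀ p : P, Alternates (proj p H)

/-- The event at position `i` is the invocation of operation `o = (p, k)`, the `k`-th operation of
process `p` (counting from `0`). -/
def IsInvAt (H : List (HEvent P Op Resp)) (o : P × ℕ) (i : ℕ) : Prop :=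
  (∃ op, H[i]? = some (.inv o.1 op)) ∧ (H.take i).countP (HEvent.isInvOf o.1) = o.2

/-- The event at position `i` is the response of operation `o = (p, k)`, the `k`-th operation of
process `p` (counting from `0`). -/
def IsResAt (H : List (HEvent P Op Resp)) (o : P × ℕ) (i : ℕ) : Prop :=
  (∃ r, H[i]? = some (.res o.1 r)) ∧ (H.take i).countP (HEvent.isResOf o.1) = o.2

/-- Real-time order: the response of `o` occurs before the invocation of `o'`. -/
def Precedes (H : List (HEvent P Op Resp)) (o o' : P × ℕ) : Prop :=
  ∃ i j, i < j ∧ IsResAt H o i ∧ IsInvAt H o' j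

/-- Delete the invocations of incomplete operations (in a well-formed history, an operation of `p`
is incomplete iff no response to `p` follows its invocation). -/
def removePending : List (HEvent P Op Resp) → List (HEvent P Op Resp)
  | [] => []
  | .inv p op :: t =>
      if t.any (HEvent.isResOf p) then .inv p op :: removePending t else removePending t
  | .res p r :: t => .res p r :: removePending t

/-- `Hc` is a completion of `H`: responses are added for some incomplete operations of `H`
(well-formedness says that each added response matches an incomplete operation), and the other
incomplete operations are removed. -/
def IsCompletion (H Hc : List (HEvent P Op Resp)) : Prop :=
  ∃ R : List (P × Resp),
    WellFormed (H ++ R.map fun x => HEvent.res x.1 x.2) ∧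
    Hc = removePending (H ++ R.map fun x => HEvent.res x.1 x.2)

/-- A complete operation: who performed it, what was invoked, what was returned. -/
structure OpRecord (P Op Resp : Type) where
  proc : P
  op : Op
  resp : Resp

/-- The complete sequential history that performs the operations of `L` one after the other. -/
def seqHistory (L : List (OpRecord P Op Resp)) : List (HEvent P Op Resp) :=
  L.flatMap fun e => [.inv e.proc e.op, .res e.proc e.resp]

end Histories

/-- The operations of `L`, performed in this order from state `q`, with the responses recorded
in `L`, satisfy the sequential specification of `τ`. -/
def Legal {P : Type} (τ : ObjType) : τ.State → List (OpRecord P τ.Op τ.Resp) → Prop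
  | _, [] => True
  | q, e :: L => ∃ q', τ.trans q e.op q' e.resp ∧ Legal τ q' L

/-- A complete history is linearizable with respect to `τ` if some sequential history is equivalent
to it, preserves its real-time order, and is consistent with the specification of `τ`. -/
def CompleteLinearizable {P : Type} [DecidableEq P] (τ : ObjType)
    (H : List (HEvent P τ.Op τ.Resp)) : Prop :=
  ∃ L : List (OpRecord P τ.Op τ.Resp),
    Equivalent H (seqHistory L) ∧
    (∀ o o' : P × ℕ, Precedes H o o' → Precedes (seqHistory L) o o') ∧
    Legal τ τ.init L

/-- A history is linearizable with respect to `τ` if it has a linearizable completion. -/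
def Linearizable {P : Type} [DecidableEq P] (τ : ObjType)
    (H : List (HEvent P τ.Op τ.Resp)) : Prop :=
  ∃ Hc, IsCompletion H Hc ∧ CompleteLinearizable τ Hc

/-! ### Shared memory -/

/-- References to nodes. `new p k` is the node that process `p` obtains from its `k`-th
allocation: an allocation returns a node that was never used before. -/
inductive Ref (n : ℕ) where
  | head
  | tail
  | new (p : Fin n) (k : ℕ)
  deriving DecidableEq

/-- Values stored in nodes: the integers together with `-∞ = ⊥` and `+∞ = ⊤`. -/
abbrev Key : Type := WithBot (WithTop ℤ)

/-- An integer as a value. -/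
def key (v : ℤ) : Key := ((v : WithTop ℤ) : WithBot (WithTop ℤ))

/-- The fields of a node; each field of each node is a separate base object. The versioned lock is
one counter: `2 * ver` encodes the unlocked and `2 * ver + 1` the locked state at version
number `ver`. -/
structure Node (n : ℕ) where
  val : Key
  next : Ref n
  deleted : Bool
  vlock : ℕ

/-- The contents of the shared memory. -/
abbrev Heap (n : ℕ) : Type := Ref n → Node n

/-- Initially the list is `head → tail`. The fields `tail.next`, and `val` and `next` of nodes not
yet allocated, have no prescribed initial value (they are never read before being written);
`deleted` and `vlock` of a new node are `false` and unlocked at version `0`. -/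
def initHeap (n : ℕ) : Heap n
  | .head => ⟨⊥, .tail, false, 0⟩
  | .tail => ⟨⊤, .tail, false, 0⟩
  | .new _ _ => ⟨⊤, .tail, false, 0⟩

/-- The version (always even) contained in a lock value: its last bit is masked out. -/
def version (x : ℕ) : ℕ := x / 2 * 2

/-! ### The algorithm -/

/-- Which update operation is executed by the code shared by `insert` and `remove`. -/
inductive Upd where
  | ins
  | rem

/-- Control states of a process, with the local variables that are live there. Every state other
than `idle` and `ret` is a point of the code at which the next thing to do is one primitive. -/
inductive PC (n : ℕ) where
  /-- no operation is in progress -/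
  | idle
  /-- the operation is about to return `b` -/
  | ret (b : Bool)
  /-- `contains`: test of `while curr.val < v` -/
  | containsTest (v : ℤ) (curr : Ref n)
  /-- `contains`: `curr ← curr.next` -/
  | containsNext (v : ℤ) (curr : Ref n)
  /-- `contains`: `curr.val = v` in the return statement -/
  | containsVal (v : ℤ) (curr : Ref n)
  /-- `contains`: `¬ curr.deleted` in the return statement -/
  | containsDel (v : ℤ) (curr : Ref n)
  /-- `waitfreeTraversal`: test of `while curr.val < v` -/
  | travTest (u : Upd) (v : ℤ) (prev curr : Ref n)
  /-- `waitfreeTraversal`: `prev ← curr; curr ← curr.next` -/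
  | travNext (u : Upd) (v : ℤ) (curr : Ref n)
  /-- `validate`, first line: `pVer ← prev.vlock.getVersion()` -/
  | valStart (u : Upd) (v : ℤ) (prev : Ref n)
  /-- `validate`: `if prev.deleted then return ⊥` -/
  | valPrevDel (u : Upd) (v : ℤ) (prev : Ref n) (pVer : ℕ)
  /-- `validate`: `curr ← prev.next` -/
  | valNext (u : Upd) (v : ℤ) (prev : Ref n) (pVer : ℕ)
  /-- `validate`: test of `while curr.val < v` -/
  | valTest (u : Upd) (v : ℤ) (prev : Ref n) (pVer : ℕ) (curr : Ref n)
  /-- `validate`: `pVer ← curr.vlock.getVersion()` -/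
  | valCurrVer (u : Upd) (v : ℤ) (prev curr : Ref n)
  /-- `validate`: `if curr.deleted then goto` the first line of `validate` -/
  | valCurrDel (u : Upd) (v : ℤ) (prev : Ref n) (pVer : ℕ) (curr : Ref n)
  /-- `insert`: `if curr.deleted then goto` the call of `validate` -/
  | insDel (v : ℤ) (prev : Ref n) (pVer : ℕ) (curr : Ref n)
  /-- `insert`: `if curr.val = v then return false` -/
  | insVal (v : ℤ) (prev : Ref n) (pVer : ℕ) (curr : Ref n)
  /-- `insert`: allocation of `newNode` and `newNode.val ← v` -/
  | insNewVal (v : ℤ) (prev : Ref n) (pVer : ℕ) (curr : Ref n)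
  /-- `insert`: `newNode.next ← curr` -/
  | insNewNext (v : ℤ) (prev : Ref n) (pVer : ℕ) (curr newNode : Ref n)
  /-- `insert`: `prev.vlock.tryLockAtVersion(pVer)` -/
  | insLock (v : ℤ) (prev : Ref n) (pVer : ℕ) (newNode : Ref n)
  /-- `insert`: `prev.next ← newNode` -/
  | insLink (prev newNode : Ref n)
  /-- `remove`: `curr.val ≠ v` in `if curr.val ≠ v ∨ curr.deleted then return false` -/
  | remVal (v : ℤ) (prev : Ref n) (pVer : ℕ) (curr : Ref n)
  /-- `remove`: `curr.deleted` in the same condition -/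
  | remDel (v : ℤ) (prev : Ref n) (pVer : ℕ) (curr : Ref n)
  /-- `remove`: `prev.vlock.tryLockAtVersion(pVer)` -/
  | remLock (v : ℤ) (prev : Ref n) (pVer : ℕ) (curr : Ref n)
  /-- `remove`: `curr.vlock.lockAtCurrentVersion()`, `ver ← getVersion()` -/
  | remSpinVer (prev curr : Ref n)
  /-- `remove`: `curr.vlock.lockAtCurrentVersion()`, `success ← tryLockAtVersion(ver)` -/
  | remSpinLock (prev curr : Ref n) (ver : ℕ)
  /-- `remove`: `curr.deleted ← true` -/
  | remMark (prev curr : Ref n)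
  /-- `remove`: the read in `prev.next ← curr.next` -/
  | remReadNext (prev curr : Ref n)
  /-- `remove`: the write in `prev.next ← curr.next` -/
  | remUnlink (prev curr nxt : Ref n)
  /-- `remove`: `curr.vlock.unlockAndIncrementVersion()`, `val ← lockValue.read()` -/
  | remUnlockRead (prev curr : Ref n)
  /-- `remove`: `curr.vlock.unlockAndIncrementVersion()`, `lockValue.CAS(val, val + 1)` -/
  | remUnlockCas (prev curr : Ref n) (x : ℕ)
  /-- `insert`, `remove`: `prev.vlock.unlockAndIncrementVersion()`, `val ← lockValue.read()` -/
  | unlockRead (prev : Ref n)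
  /-- `insert`, `remove`: `prev.vlock.unlockAndIncrementVersion()`,
  `lockValue.CAS(val, val + 1)` -/
  | unlockCas (prev : Ref n) (x : ℕ)

/-- The local state of a process: its control state and the number of its allocations so far. -/
structure Local (n : ℕ) where
  pc : PC n
  allocs : ℕ

/-- What a process does next: one primitive on one base object, with a continuation that maps the
response of the primitive to the next local state; or nothing. -/
inductive Action (n : ℕ) where
  | readVal (a : Ref n) (k : Key → Local n)
  | readNext (a : Ref n) (k : Ref n → Local n)
  | readDeleted (a : Ref n) (k : Bool → Local n)
  | readLock (a : Ref n) (k : ℕ → Local n)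
  | casLock (a : Ref n) (expected new : ℕ) (k : Bool → Local n)
  | writeVal (a : Ref n) (x : Key) (k : Local n)
  | writeNext (a : Ref n) (b : Ref n) (k : Local n)
  | writeDeleted (a : Ref n) (d : Bool) (k : Local n)
  | none

/-- The effect of the primitive on the shared memory, and the new local state. -/
def Action.run {n : ℕ} (M : Heap n) : Action n → Option (Heap n × Local n)
  | .readVal a k => some (M, k (M a).val)
  | .readNext a k => some (M, k (M a).next)
  | .readDeleted a k => some (M, k (M a).deleted)
  | .readLock a k => some (M, k (M a).vlock)
  | .casLock a x y k =>
      if (M a).vlock = x then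
        some (Function.update M a { M a with vlock := y }, k true)
      else
        some (M, k false)
  | .writeVal a x k => some (Function.update M a { M a with val := x }, k)
  | .writeNext a b k => some (Function.update M a { M a with next := b }, k)
  | .writeDeleted a d k => some (Function.update M a { M a with deleted := d }, k)
  | .none => Option.none

/-- The first control state of an operation. -/
def startPC {n : ℕ} : SetOp → PC n
  | .contains v => .containsTest v .head
  | .insert v => .travTest .ins v .head .head
  | .remove v => .travTest .rem v .head .head

/-- The code of process `p`. -/
noncomputable def action {n : ℕ} (p : Fin n) (s : Local n) : Action n :=
  let goto (c : PC n) : Local n := { s with pc := c }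
  match s.pc with
  | .idle => .none
  | .ret _ => .none
  -- contains
  | .containsTest v curr => .readVal curr fun x =>
      if x < key v then goto (.containsNext v curr) else goto (.containsVal v curr)
  | .containsNext v curr => .readNext curr fun c => goto (.containsTest v c)
  | .containsVal v curr => .readVal curr fun x =>
      if x = key v then goto (.containsDel v curr) else goto (.ret false)
  | .containsDel _ curr => .readDeleted curr fun d => goto (.ret (!d))
  -- waitfreeTraversal
  | .travTest u v prev curr => .readVal curr fun x =>
      if x < key v then goto (.travNext u v curr) else goto (.valStart u v prev)
  | .travNext u v curr => .readNext curr fun c => goto (.travTest u v curr c)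
  -- validate
  | .valStart u v prev => .readLock prev fun x => goto (.valPrevDel u v prev (version x))
  | .valPrevDel u v prev pVer => .readDeleted prev fun d =>
      if d then goto (.travTest u v .head .head) else goto (.valNext u v prev pVer)
  | .valNext u v prev pVer => .readNext prev fun c => goto (.valTest u v prev pVer c)
  | .valTest u v prev pVer curr => .readVal curr fun x =>
      if x < key v then goto (.valCurrVer u v prev curr)
      else match u with
        | .ins => goto (.insDel v prev pVer curr)
        | .rem => goto (.remVal v prev pVer curr)
  | .valCurrVer u v prev curr => .readLock curr fun x =>
      goto (.valCurrDel u v prev (version x) curr)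
  | .valCurrDel u v prev pVer curr => .readDeleted curr fun d =>
      -- otherwise `prev ← curr; curr ← curr.next`, which is `curr ← prev.next` for the new `prev`
      if d then goto (.valStart u v prev) else goto (.valNext u v curr pVer)
  -- insert, after validate
  | .insDel v prev pVer curr => .readDeleted curr fun d =>
      if d then goto (.valStart .ins v prev) else goto (.insVal v prev pVer curr)
  | .insVal v prev pVer curr => .readVal curr fun x =>
      if x = key v then goto (.ret false) else goto (.insNewVal v prev pVer curr)
  | .insNewVal v prev pVer curr => .writeVal (.new p s.allocs) (key v)
      { pc := .insNewNext v prev pVer curr (.new p s.allocs), allocs := s.allocs + 1 }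
  | .insNewNext v prev pVer curr newNode =>
      .writeNext newNode curr (goto (.insLock v prev pVer newNode))
  | .insLock v prev pVer newNode => .casLock prev pVer (pVer + 1) fun ok =>
      if ok then goto (.insLink prev newNode) else goto (.valStart .ins v prev)
  | .insLink prev newNode => .writeNext prev newNode (goto (.unlockRead prev))
  -- remove, after validate
  | .remVal v prev pVer curr => .readVal curr fun x =>
      if x = key v then goto (.remDel v prev pVer curr) else goto (.ret false)
  | .remDel v prev pVer curr => .readDeleted curr fun d =>
      if d then goto (.ret false) else goto (.remLock v prev pVer curr)
  | .remLock v prev pVer curr => .casLock prev pVer (pVer + 1) fun ok =>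
      if ok then goto (.remSpinVer prev curr) else goto (.valStart .rem v prev)
  | .remSpinVer prev curr => .readLock curr fun x => goto (.remSpinLock prev curr (version x))
  | .remSpinLock prev curr ver => .casLock curr ver (ver + 1) fun ok =>
      if ok then goto (.remMark prev curr) else goto (.remSpinVer prev curr)
  | .remMark prev curr => .writeDeleted curr true (goto (.remReadNext prev curr))
  | .remReadNext prev curr => .readNext curr fun c => goto (.remUnlink prev curr c)
  | .remUnlink prev curr nxt => .writeNext prev nxt (goto (.remUnlockRead prev curr))
  | .remUnlockRead prev curr => .readLock curr fun x => goto (.remUnlockCas prev curr x)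
  | .remUnlockCas prev curr x => .casLock curr x (x + 1) fun _ => goto (.unlockRead prev)
  -- last unlock of insert and remove
  | .unlockRead prev => .readLock prev fun x => goto (.unlockCas prev x)
  | .unlockCas prev x => .casLock prev x (x + 1) fun _ => goto (.ret true)

/-! ### Executions -/

/-- A configuration: the shared memory and the local state of each of the `n` processes. -/
structure Config (n : ℕ) where
  mem : Heap n
  loc : Fin n → Local n

/-- The initial configuration. -/
def initConfig (n : ℕ) : Config n where
  mem := initHeap n
  loc := fun _ => ⟨.idle, 0⟩

/-- Events: invocations, primitives applied to base objects, and responses. (Since processes are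
deterministic, the configuration determines which primitive a process applies and its outcome.) -/
inductive Event (n : ℕ) where
  | inv (p : Fin n) (op : SetOp)
  | prim (p : Fin n)
  | res (p : Fin n) (r : Bool)

/-- `Step C e C'`: event `e` may occur in configuration `C`, and leads to `C'`. -/
inductive Step {n : ℕ} : Config n → Event n → Config n → Prop where
  | inv (C : Config n) (p : Fin n) (op : SetOp) (h : (C.loc p).pc = .idle) :
      Step C (.inv p op)
        { C with loc := Function.update C.loc p { C.loc p with pc := startPC op } }
  | prim (C : Config n) (p : Fin n) (M : Heap n) (s : Local n)
      (h : (action p (C.loc p)).run C.mem = some (M, s)) :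
      Step C (.prim p) { mem := M, loc := Function.update C.loc p s }
  | res (C : Config n) (p : Fin n) (r : Bool) (h : (C.loc p).pc = .ret r) :
      Step C (.res p r)
        { C with loc := Function.update C.loc p { C.loc p with pc := .idle } }

/-- `Reaches α C`: the sequence of events `α` can occur from the initial configuration, and leads
to `C`. The processes are scheduled arbitrarily. -/
inductive Reaches {n : ℕ} : List (Event n) → Config n → Prop where
  | nil : Reaches [] (initConfig n)
  | snoc {α : List (Event n)} {C C' : Config n} {e : Event n} :
      Reaches α C → Step C e C' → Reaches (α ++ [e]) C'

/-- A finite execution of the algorithm with `n` processes. -/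
def IsExecution {n : ℕ} (α : List (Event n)) : Prop :=
  ∃ C, Reaches α C

/-- The high-level history of an execution: its invocations and responses. -/
def history {n : ℕ} (α : List (Event n)) : List (HEvent (Fin n) setType.Op setType.Resp) :=
  α.filterMap fun e =>
    match e with
    | .inv p op => some (.inv p op)
    | .prim _ => Option.none
    | .res p r => some (.res p r)

end VersionedList

/-!
Every operation is assigned a linearization point between its invocation and its response. An
`insert` that returns true takes effect when it writes `prev.next`, a `remove` that returns true
when it sets `curr.deleted`. The abstract set consists of the values of the unmarked nodes on the
chain from `head` to `tail`, and these two steps are the only ones that change it.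

*Locks.* The counter of a lock never decreases, and an even version at which a CAS succeeds was
current, with the lock free, ever since it was read. Hence what `validate` has read from `prev`
after the version (that it is unmarked and that `curr` is its successor) still holds when the lock
is acquired, and it remains true while the lock is held (`Undisturbed`, `PCInv.stable`). So the
chain stays sorted when a node is linked or unlinked (`Evolves.link`, `Evolves.unlink`).

*Hindsight.* The other operations leave the set unchanged, and for these it suffices that the
value in question was present, respectively absent, at some time since the invocation. A node
is marked before it is unlinked, and afterwards its successor and its mark never change. So every
link that a traversal follows was on the chain at some time since the invocation, possibly before
it was read (`Hindsight.seen_next`): if it leads from a value below `v` to a value above `v`, then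
`v` was absent at that time. In the same way, a node with value `v` that is found to be marked
shows that `v` was absent at some time since the invocation (`Hindsight.absent_of_deleted`). That
time is known only when the operation is about to return, and then a linearization point
is inserted retroactively into the past (`LinTrace.lin_past`).

`Sim` combines a partial linearization (`LinTrace`) with the invariant of the algorithm (`Inv`), and
it is preserved by every step (`Sim.inv`, `Sim.prim`, `Sim.res`). A partial linearization is
completed by letting the linearized operations return and dropping the others
(`LinTrace.linearizable`).
-/

namespace VersionedList

/-! ### Traces with linearization points -/

section Traces

/-- Events of a history in which also the linearization points of operations are recorded:
`lin p op r` says that the operation `op` of process `p` takes effect and will return `r`. -/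
inductive XEvent (P Op Resp : Type) where
  | inv (p : P) (op : Op)
  | lin (p : P) (op : Op) (r : Resp)
  | res (p : P) (r : Resp)

/-- The progress of a process in its operation: none is in progress, the operation in progress has
not been linearized yet, or it has been linearized with response `r`. -/
inductive Status (Op Resp : Type) where
  | idle
  | pend (op : Op)
  | done (r : Resp)

variable {P Op Resp : Type}

/-- The number of invocations without linearization point. -/
def Status.numPending : Status Op Resp → ℕ
  | .pend _ => 1
  | _ => 0

/-- The number of linearization points without response. -/
def Status.numDone : Status Op Resp → ℕ
  | .done _ => 1
  | _ => 0

/-- The invocation that waits for its linearization point. -/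
def Status.pendingInv (p : P) : Status Op Resp → List (HEvent P Op Resp)
  | .pend op => [.inv p op]
  | _ => []

/-- The response of an operation that has been linearized and has not returned. -/
def Status.pendingRes (p : P) : Status Op Resp → List (HEvent P Op Resp)
  | .done r => [.res p r]
  | _ => []

/-- The process to which an event belongs. -/
def XEvent.proc : XEvent P Op Resp → P
  | .inv p _ => p
  | .lin p _ _ => p
  | .res p _ => p

/-- The invocations and responses of a trace. -/
def visible (E : List (XEvent P Op Resp)) : List (HEvent P Op Resp) :=
  E.filterMap fun e =>
    match e with
    | .inv p op => some (.inv p op)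
    | .lin _ _ _ => none
    | .res p r => some (.res p r)

/-- The operations of a trace in the order of their linearization points. -/
def records (E : List (XEvent P Op Resp)) : List (OpRecord P Op Resp) :=
  E.filterMap fun e =>
    match e with
    | .lin p op r => some ⟨p, op, r⟩
    | _ => none

/-- `Runs p s E s'`: in the trace `E` the events of process `p` cycle through invocation,
linearization point and matching response, and they lead from status `s` to status `s'`. -/
inductive Runs (p : P) : Status Op Resp → List (XEvent P Op Resp) → Status Op Resp → Prop where
  | nil {s} : Runs p s [] s
  | skip {s s' e t} (he : e.proc ≠ p) (h : Runs p s t s') : Runs p s (e :: t) s'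
  | inv {s' op t} (h : Runs p (.pend op) t s') : Runs p .idle (.inv p op :: t) s'
  | lin {s' op r t} (h : Runs p (.done r) t s') : Runs p (.pend op) (.lin p op r :: t) s'
  | res {s' r t} (h : Runs p .idle t s') : Runs p (.done r) (.res p r :: t) s'

namespace Runs

variable {p : P} {s s' s'' : Status Op Resp} {E E' : List (XEvent P Op Resp)}

theorem append (h : Runs p s E s') (h' : Runs p s' E' s'') : Runs p s (E ++ E') s'' := by
  induction h with
  | nil => exact h'
  | skip he _ ih => exact .skip he (ih h')
  | inv _ ih => exact .inv (ih h')
  | lin _ ih => exact .lin (ih h')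
  | res _ ih => exact .res (ih h')

theorem split (h : Runs p s (E ++ E') s'') : ∃ s', Runs p s E s' ∧ Runs p s' E' s'' := by
  induction E generalizing s with
  | nil => exact ⟨s, .nil, h⟩
  | cons e t ih =>
    cases h with
    | skip he h => obtain ⟨s', h1, h2⟩ := ih h; exact ⟨s', .skip he h1, h2⟩
    | inv h => obtain ⟨s', h1, h2⟩ := ih h; exact ⟨s', .inv h1, h2⟩
    | lin h => obtain ⟨s', h1, h2⟩ := ih h; exact ⟨s', .lin h1, h2⟩
    | res h => obtain ⟨s', h1, h2⟩ := ih h; exact ⟨s', .res h1, h2⟩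

theorem of_forall_ne (hE : ∀ e ∈ E, e.proc ≠ p) : Runs p s E s := by
  induction E with
  | nil => exact .nil
  | cons e t ih =>
    exact .skip (hE e (by simp)) (ih fun e' he' => hE e' (by simp [he']))

theorem eq_of_forall_ne (h : Runs p s E s') (hE : ∀ e ∈ E, e.proc ≠ p) : s' = s := by
  induction h with
  | nil => rfl
  | skip _ _ ih => exact ih fun e' he' => hE e' (by simp [he'])
  | inv => exact absurd rfl (hE _ List.mem_cons_self)
  | lin => exact absurd rfl (hE _ List.mem_cons_self)
  | res => exact absurd rfl (hE _ List.mem_cons_self)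

theorem inv_cons {op : Op} (h : Runs p s (.inv p op :: E) s') :
    s = .idle ∧ Runs p (.pend op) E s' := by
  cases h with
  | skip he => exact absurd rfl he
  | inv h => exact ⟨rfl, h⟩

theorem res_cons {r : Resp} (h : Runs p s (.res p r :: E) s') :
    s = .done r ∧ Runs p .idle E s' := by
  cases h with
  | skip he => exact absurd rfl he
  | res h => exact ⟨rfl, h⟩

end Runs

theorem visible_append (E E' : List (XEvent P Op Resp)) :
    visible (E ++ E') = visible E ++ visible E' := List.filterMap_append

theorem records_append (E E' : List (XEvent P Op Resp)) :
    records (E ++ E') = records E ++ records E' := List.filterMap_append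

@[simp] theorem visible_nil : visible ([] : List (XEvent P Op Resp)) = [] := rfl
@[simp] theorem visible_inv (p : P) (op : Op) (E : List (XEvent P Op Resp)) :
    visible (.inv p op :: E) = .inv p op :: visible E := rfl
@[simp] theorem visible_lin (p : P) (op : Op) (r : Resp) (E : List (XEvent P Op Resp)) :
    visible (.lin p op r :: E) = visible E := rfl
@[simp] theorem visible_res (p : P) (r : Resp) (E : List (XEvent P Op Resp)) :
    visible (.res p r :: E) = .res p r :: visible E := rfl
@[simp] theorem records_nil : records ([] : List (XEvent P Op Resp)) = [] := rfl
@[simp] theorem records_inv (p : P) (op : Op) (E : List (XEvent P Op Resp)) :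
    records (.inv p op :: E) = records E := rfl
@[simp] theorem records_lin (p : P) (op : Op) (r : Resp) (E : List (XEvent P Op Resp)) :
    records (.lin p op r :: E) = ⟨p, op, r⟩ :: records E := rfl
@[simp] theorem records_res (p : P) (r : Resp) (E : List (XEvent P Op Resp)) :
    records (.res p r :: E) = records E := rfl

theorem seqHistory_cons (e : OpRecord P Op Resp) (L : List (OpRecord P Op Resp)) :
    seqHistory (e :: L) = .inv e.proc e.op :: .res e.proc e.resp :: seqHistory L := by
  simp [seqHistory]

theorem seqHistory_append (L L' : List (OpRecord P Op Resp)) :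
    seqHistory (L ++ L') = seqHistory L ++ seqHistory L' := by
  simp [seqHistory]

theorem visible_eq_append {E : List (XEvent P Op Resp)} {H1 H2 : List (HEvent P Op Resp)}
    (h : visible E = H1 ++ H2) : ∃ E1 E2, E = E1 ++ E2 ∧ visible E1 = H1 ∧ visible E2 = H2 :=
  List.filterMap_eq_append_iff.1 h

theorem visible_eq_res {E : List (XEvent P Op Resp)} {H : List (HEvent P Op Resp)} {p : P}
    {r : Resp} (h : visible E = .res p r :: H) :
    ∃ E1 E2, E = E1 ++ .res p r :: E2 ∧ visible E1 = [] ∧ visible E2 = H := by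
  obtain ⟨E1, e, E2, rfl, h1, h2, h3⟩ := List.filterMap_eq_cons_iff.1 h
  refine ⟨E1, E2, ?_, List.filterMap_eq_nil_iff.2 h1, h3⟩
  cases e <;> simp_all

theorem visible_eq_inv {E : List (XEvent P Op Resp)} {H : List (HEvent P Op Resp)} {p : P}
    {op : Op} (h : visible E = .inv p op :: H) :
    ∃ E1 E2, E = E1 ++ .inv p op :: E2 ∧ visible E1 = [] ∧ visible E2 = H := by
  obtain ⟨E1, e, E2, rfl, h1, h2, h3⟩ := List.filterMap_eq_cons_iff.1 h
  refine ⟨E1, E2, ?_, List.filterMap_eq_nil_iff.2 h1, h3⟩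
  cases e <;> simp_all

theorem eq_take_append {α : Type} {H : List α} {i : ℕ} {a : α} (h : H[i]? = some a) :
    H = H.take i ++ a :: H.drop (i + 1) := by
  obtain ⟨hi, rfl⟩ := List.getElem?_eq_some_iff.1 h
  simp

theorem exists_split_of_lt_countP {α : Type} (f : α → Bool) (k : ℕ) (L : List α)
    (h : k < L.countP f) : ∃ A e B, L = A ++ e :: B ∧ f e ∧ A.countP f = k := by
  induction L generalizing k with
  | nil => simp at h
  | cons a L ih =>
    by_cases ha : f a
    · cases k with
      | zero => exact ⟨[], a, L, rfl, ha, rfl⟩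
      | succ k =>
        obtain ⟨A, e, B, rfl, he, hA⟩ := ih k (by simpa [ha] using h)
        exact ⟨a :: A, e, B, rfl, he, by simp [ha, hA]⟩
    · obtain ⟨A, e, B, rfl, he, hA⟩ := ih k (by simpa [ha] using h)
      exact ⟨a :: A, e, B, rfl, he, by simp [ha, hA]⟩

theorem length_seqHistory (L : List (OpRecord P Op Resp)) :
    (seqHistory L).length = 2 * L.length := by
  induction L with
  | nil => rfl
  | cons e L ih => simp [seqHistory_cons, ih]; ring

variable [DecidableEq P]

section Projection

variable (p q : P) (op : Op) (r : Resp) (H : List (HEvent P Op Resp))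

theorem proj_cons_inv : proj p (.inv q op :: H) =
    if q = p then .inv q op :: proj p H else proj p H := by
  by_cases h : q = p <;> simp [proj, HEvent.isInvOf, HEvent.isResOf, h]

theorem proj_cons_res : proj p (.res q r :: H) =
    if q = p then .res q r :: proj p H else proj p H := by
  by_cases h : q = p <;> simp [proj, HEvent.isInvOf, HEvent.isResOf, h]

end Projection

/-- Reading the operation in progress at the beginning into account, the visible events of a
process form a well-formed history. -/
theorem Runs.alternates {p : P} {s s' : Status Op Resp} {E : List (XEvent P Op Resp)}
    (h : Runs p s E s') :
    (s = .idle → Alternates (proj p (visible E))) ∧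
    (s ≠ .idle → ∀ op : Op, Alternates (.inv p op :: proj p (visible E))) := by
  induction h with
  | @nil s => simp [proj, Alternates]
  | @skip s s' e t he h ih =>
    have : proj p (visible (e :: t)) = proj p (visible t) := by
      cases e <;> simp_all [XEvent.proc, proj_cons_inv, proj_cons_res]
    rw [this]; exact ih
  | inv h ih => simpa [proj_cons_inv] using ih.2 (by simp) _
  | lin h ih => simpa using ih.2 (by simp)
  | res h ih => simpa [proj_cons_res, Alternates] using fun _ : Op => ih.1 rfl

theorem Runs.wellFormed {E : List (XEvent P Op Resp)} {st : P → Status Op Resp}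
    (h : ∀ p, Runs p .idle E (st p)) : WellFormed (visible E) :=
  fun p => (h p).alternates.1 rfl

/-- If no operation is in progress at the end, then every process sees the same events in the
trace and in the sequential history given by the linearization points. -/
theorem Runs.proj_eq {p : P} {s : Status Op Resp} {E : List (XEvent P Op Resp)}
    (h : Runs p s E .idle) :
    s.pendingInv p ++ proj p (visible E) =
      s.pendingRes p ++ proj p (seqHistory (records E)) := by
  generalize hs' : (Status.idle : Status Op Resp) = s' at h
  induction h with
  | nil => subst hs'; rfl
  | @skip s s' e t he h ih =>
    have h1 : proj p (visible (e :: t)) = proj p (visible t) := by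
      cases e <;> simp_all [XEvent.proc, proj_cons_inv, proj_cons_res]
    have h2 : proj p (seqHistory (records (e :: t))) = proj p (seqHistory (records t)) := by
      cases e <;> simp_all [XEvent.proc, proj_cons_inv, proj_cons_res, seqHistory_cons]
    rw [h1, h2]; exact ih hs'
  | inv h ih => simpa [Status.pendingInv, Status.pendingRes, proj_cons_inv] using ih hs'
  | lin h ih => simpa [Status.pendingInv, Status.pendingRes, seqHistory_cons, proj_cons_inv,
      proj_cons_res] using ih hs'
  | res h ih => simpa [Status.pendingInv, Status.pendingRes, proj_cons_res] using ih hs'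

/-- The operation belongs to process `p`. -/
def OpRecord.isOf (p : P) (e : OpRecord P Op Resp) : Bool := decide (e.proc = p)

/-- Invocations and linearization points of a process alternate: the invocations are one ahead
exactly while an operation is pending. -/
theorem Runs.countP_inv {p : P} {s s' : Status Op Resp} {E : List (XEvent P Op Resp)}
    (h : Runs p s E s') :
    (visible E).countP (HEvent.isInvOf p) + s.numPending =
      (records E).countP (OpRecord.isOf p) + s'.numPending := by
  induction h with
  | nil => simp
  | @skip s s' e t he h ih =>
    cases e <;> simp only [XEvent.proc] at he <;>
      simpa [HEvent.isInvOf, OpRecord.isOf, he] using ih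
  | inv h ih => simp [HEvent.isInvOf, Status.numPending] at ih ⊢; omega
  | lin h ih => simp [OpRecord.isOf, Status.numPending] at ih ⊢; omega
  | res h ih => simp [HEvent.isInvOf, Status.numPending] at ih ⊢; omega

/-- Linearization points and responses of a process alternate: the linearization points are one
ahead exactly while a linearized operation has not returned. -/
theorem Runs.countP_res {p : P} {s s' : Status Op Resp} {E : List (XEvent P Op Resp)}
    (h : Runs p s E s') :
    (visible E).countP (HEvent.isResOf p) + s'.numDone =
      (records E).countP (OpRecord.isOf p) + s.numDone := by
  induction h with
  | nil => simp
  | @skip s s' e t he h ih =>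
    cases e <;> simp only [XEvent.proc] at he <;>
      simpa [HEvent.isResOf, OpRecord.isOf, he] using ih
  | inv h ih => simp [HEvent.isResOf, Status.numDone] at ih ⊢; omega
  | lin h ih => simp [OpRecord.isOf, Status.numDone] at ih ⊢; omega
  | res h ih => simp [HEvent.isResOf, Status.numDone] at ih ⊢; omega

theorem countP_inv_seqHistory (p : P) (L : List (OpRecord P Op Resp)) :
    (seqHistory L).countP (HEvent.isInvOf p) = L.countP (OpRecord.isOf p) := by
  induction L with
  | nil => rfl
  | cons e L ih =>
    simp [seqHistory_cons, List.countP_cons, ih, HEvent.isInvOf, OpRecord.isOf]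

theorem countP_res_seqHistory (p : P) (L : List (OpRecord P Op Resp)) :
    (seqHistory L).countP (HEvent.isResOf p) = L.countP (OpRecord.isOf p) := by
  induction L with
  | nil => rfl
  | cons e L ih =>
    simp [seqHistory_cons, List.countP_cons, ih, HEvent.isResOf, OpRecord.isOf]

theorem isInvAt_seqHistory (A B : List (OpRecord P Op Resp)) (e : OpRecord P Op Resp) :
    IsInvAt (seqHistory (A ++ e :: B)) (e.proc, A.countP (OpRecord.isOf e.proc))
      (2 * A.length) := by
  rw [seqHistory_append, seqHistory_cons, ← length_seqHistory]
  refine ⟨⟨e.op, by simp⟩, ?_⟩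
  simp [countP_inv_seqHistory]

theorem isResAt_seqHistory (A B : List (OpRecord P Op Resp)) (e : OpRecord P Op Resp) :
    IsResAt (seqHistory (A ++ e :: B)) (e.proc, A.countP (OpRecord.isOf e.proc))
      (2 * A.length + 1) := by
  rw [seqHistory_append, seqHistory_cons, ← length_seqHistory]
  refine ⟨⟨e.resp, by simp⟩, ?_⟩
  rw [List.take_append, List.take_of_length_le (Nat.le_succ _), Nat.add_sub_cancel_left]
  simp [countP_res_seqHistory, HEvent.isResOf]

/-- Linearization points lie between invocation and response, so ordering the operations by their
linearization points preserves the real-time order. -/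
theorem precedes_seqHistory {E : List (XEvent P Op Resp)} (hE : ∀ p, Runs p .idle E .idle)
    {o o' : P × ℕ} (h : Precedes (visible E) o o') : Precedes (seqHistory (records E)) o o' := by
  obtain ⟨p, k⟩ := o
  obtain ⟨p', k'⟩ := o'
  obtain ⟨i, j, hij, ⟨⟨r, hr⟩, hk⟩, ⟨⟨op, hop⟩, hk'⟩⟩ := h
  simp only at hr hk hop hk'
  have hr' : ((visible E).take j)[i]? = some (.res p r) := by
    rw [List.getElem?_take, if_pos hij, hr]
  obtain ⟨E1, E2, rfl, h1, h2⟩ := visible_eq_append (eq_take_append hop)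
  obtain ⟨E2a, E2b, rfl, h2a, -⟩ := visible_eq_inv h2
  rw [← h1] at hr' hk'
  have htake : (visible E1).take i = (visible (E1 ++ (E2a ++ .inv p' op :: E2b))).take i := by
    rw [h1, List.take_take, min_eq_left hij.le]
  rw [← htake] at hk
  obtain ⟨E3, E4, rfl, h3, h4⟩ := visible_eq_append (eq_take_append hr')
  obtain ⟨E4a, E4b, rfl, h4a, -⟩ := visible_eq_res h4
  rw [← h3] at hk
  -- the operation of `p` has been linearized before its response
  have hp : k < (records (E3 ++ E4a)).countP (OpRecord.isOf p) := by
    have h := hE p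
    rw [show E3 ++ (E4a ++ XEvent.res p r :: E4b) ++ (E2a ++ .inv p' op :: E2b) =
      (E3 ++ E4a) ++ (XEvent.res p r :: (E4b ++ (E2a ++ .inv p' op :: E2b))) by simp] at h
    obtain ⟨s, ha, hb⟩ := h.split
    obtain ⟨rfl, -⟩ := hb.res_cons
    have hc := ha.countP_res
    simp only [visible_append, h4a, List.append_nil, Status.numDone] at hc
    omega
  -- the operation of `p'` is linearized after its invocation
  have hp' : (records (E3 ++ (E4a ++ XEvent.res p r :: E4b) ++ E2a)).countP
      (OpRecord.isOf p') = k' ∧ 0 < (records E2b).countP (OpRecord.isOf p') := by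
    have h := hE p'
    rw [← List.append_assoc (E3 ++ (E4a ++ XEvent.res p r :: E4b)) E2a] at h
    obtain ⟨s, ha, hb⟩ := h.split
    obtain ⟨rfl, hb'⟩ := hb.inv_cons
    have hc := ha.countP_inv
    have hd := hb'.countP_inv
    rw [visible_append, h2a, List.append_nil] at hc
    simp only [Status.numPending] at hc hd
    omega
  obtain ⟨hp', hpos⟩ := hp'
  obtain ⟨A, e, B, hA, he, hAk⟩ := exists_split_of_lt_countP _ _ _ hp
  obtain ⟨A', e', B', hA', he', hAk'⟩ := exists_split_of_lt_countP _ _ _ hpos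
  obtain rfl : e.proc = p := by simpa [OpRecord.isOf] using he
  obtain rfl : e'.proc = p' := by simpa [OpRecord.isOf] using he'
  have eq1 : records (E3 ++ (E4a ++ XEvent.res e.proc r :: E4b) ++
      (E2a ++ .inv e'.proc op :: E2b)) =
      A ++ e :: (B ++ records E4b ++ records E2a ++ records E2b) := by
    have := congrArg (· ++ (records E4b ++ records E2a ++ records E2b)) hA
    simpa [records_append] using this
  have eq2 : records (E3 ++ (E4a ++ XEvent.res e.proc r :: E4b) ++
      (E2a ++ .inv e'.proc op :: E2b)) =
      (records (E3 ++ (E4a ++ XEvent.res e.proc r :: E4b) ++ E2a) ++ A') ++ e' :: B' := by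
    simp [records_append, hA']
  refine ⟨2 * A.length + 1, 2 * (records (E3 ++ (E4a ++ XEvent.res e.proc r :: E4b) ++ E2a) ++
    A').length, ?_, ?_, ?_⟩
  · have := congrArg List.length hA
    simp only [records_append, records_res, List.length_append, List.length_cons] at this ⊢
    omega
  · rw [eq1, ← hAk]; exact isResAt_seqHistory _ _ _
  · rw [eq2]
    have := isInvAt_seqHistory
      (records (E3 ++ (E4a ++ XEvent.res e.proc r :: E4b) ++ E2a) ++ A') B' e'
    rwa [List.countP_append, hp', hAk', Nat.add_zero] at this

/-- The event is a response to process `p`. -/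
def XEvent.isResOf (p : P) : XEvent P Op Resp → Bool
  | .res q _ => decide (q = p)
  | _ => false

/-- The counterpart of `removePending` for traces. -/
def dropPending : List (XEvent P Op Resp) → List (XEvent P Op Resp)
  | [] => []
  | .inv p op :: t =>
      if t.any (XEvent.isResOf p) then .inv p op :: dropPending t else dropPending t
  | .lin p op r :: t => .lin p op r :: dropPending t
  | .res p r :: t => .res p r :: dropPending t

theorem any_isResOf_visible (p : P) (E : List (XEvent P Op Resp)) :
    (visible E).any (HEvent.isResOf p) = E.any (XEvent.isResOf p) := by
  induction E with
  | nil => rfl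
  | cons e t ih => cases e <;> simp [ih, HEvent.isResOf, XEvent.isResOf]

theorem visible_dropPending (E : List (XEvent P Op Resp)) :
    visible (dropPending E) = removePending (visible E) := by
  induction E with
  | nil => rfl
  | cons e t ih =>
    cases e with
    | inv p op =>
      simp only [dropPending, visible_inv, removePending, any_isResOf_visible]
      split <;> simp [ih]
    | lin => simpa [dropPending] using ih
    | res => simpa [dropPending, removePending] using ih

theorem records_dropPending (E : List (XEvent P Op Resp)) :
    records (dropPending E) = records E := by
  induction E with
  | nil => rfl
  | cons e t ih =>
    cases e with
    | inv p op => simp only [dropPending, records_inv]; split <;> simp [ih]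
    | lin => simpa [dropPending] using ih
    | res => simpa [dropPending] using ih

theorem mem_of_mem_dropPending {E : List (XEvent P Op Resp)} {e : XEvent P Op Resp}
    (h : e ∈ dropPending E) : e ∈ E := by
  induction E with
  | nil => exact h
  | cons a t ih =>
    cases a with
    | inv p op =>
      simp only [dropPending] at h
      split at h
      · rcases List.mem_cons.1 h with rfl | h
        · simp
        · simp [ih h]
      · simp [ih h]
    | lin =>
      rcases List.mem_cons.1 h with rfl | h
      · simp
      · simp [ih h]
    | res =>
      rcases List.mem_cons.1 h with rfl | h
      · simp
      · simp [ih h]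

theorem Runs.forall_ne_of_pend {p : P} {op : Op} {s : Status Op Resp}
    {E : List (XEvent P Op Resp)} (h : Runs p (.pend op) E s) (hs : ∀ r, s ≠ .done r)
    (hE : E.any (XEvent.isResOf p) = false) : ∀ e ∈ E, e.proc ≠ p := by
  induction E with
  | nil => simp
  | cons e t ih =>
    have ht : t.any (XEvent.isResOf p) = false := by
      rw [List.any_cons, Bool.or_eq_false_iff] at hE; exact hE.2
    cases h with
    | skip he h =>
      intro e' he'
      rcases List.mem_cons.1 he' with rfl | he'
      · exact he
      · exact ih h ht e' he'
    | lin h =>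
      have := h.countP_res
      have h0 : (visible t).countP (HEvent.isResOf p) = 0 := by
        rw [List.countP_eq_zero]
        intro a ha hap
        have : (visible t).any (HEvent.isResOf p) = true := List.any_eq_true.2 ⟨a, ha, hap⟩
        rw [any_isResOf_visible, ht] at this
        exact absurd this (by simp)
      cases s with
      | done r => exact absurd rfl (hs r)
      | _ => simp only [Status.numDone] at this; omega

/-- If every linearized operation has returned, then dropping the other invocations leaves only
complete operations. -/
theorem Runs.dropPending {p : P} {s s' : Status Op Resp} {E : List (XEvent P Op Resp)}
    (h : Runs p s E s') (hs' : ∀ r, s' ≠ .done r)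
    (hs : s = .idle ∨ E.any (XEvent.isResOf p) = true) :
    Runs p s (dropPending E) .idle := by
  induction h with
  | nil =>
    obtain rfl : _ = Status.idle := by simpa using hs
    exact .nil
  | @skip s s' e t he h ih =>
    have hs2 : s = .idle ∨ t.any (XEvent.isResOf p) = true := by
      refine hs.imp_right fun h => ?_
      cases e <;> simp_all [XEvent.isResOf, XEvent.proc]
    have h2 := ih hs' hs2
    cases e with
    | inv q op =>
      simp only [VersionedList.dropPending]
      split
      · exact .skip he h2
      · exact h2
    | lin => exact .skip he h2
    | res => exact .skip he h2
  | @inv s' op t h ih =>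
    simp only [VersionedList.dropPending]
    split
    next ht => exact .inv (ih hs' (.inr ht))
    next ht =>
      exact of_forall_ne fun e he =>
        h.forall_ne_of_pend hs' (by simpa using ht) e (mem_of_mem_dropPending he)
  | @lin s' op r t h ih =>
    exact .lin (ih hs' (by simpa [XEvent.isResOf] using hs))
  | @res s' r t h ih => exact .res (ih hs' (.inl rfl))

end Traces

/-! ### Partial linearizations -/

section LinTrace

variable {P : Type} {τ : ObjType}

/-- `SRuns q E q'`: the linearization points of `E` are transitions of `τ` that lead from state `q`
to state `q'`. -/
inductive SRuns : τ.State → List (XEvent P τ.Op τ.Resp) → τ.State → Prop where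
  | nil {q} : SRuns q [] q
  | inv {q q' p op t} (h : SRuns q t q') : SRuns q (.inv p op :: t) q'
  | res {q q' p r t} (h : SRuns q t q') : SRuns q (.res p r :: t) q'
  | lin {q q' q'' p op r t} (ht : τ.trans q op q' r) (h : SRuns q' t q'') :
      SRuns q (.lin p op r :: t) q''

namespace SRuns

variable {q q' q'' : τ.State} {E E' : List (XEvent P τ.Op τ.Resp)}

theorem append (h : SRuns q E q') (h' : SRuns q' E' q'') : SRuns q (E ++ E') q'' := by
  induction h with
  | nil => exact h'
  | inv _ ih => exact .inv (ih h')
  | res _ ih => exact .res (ih h')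
  | lin ht _ ih => exact .lin ht (ih h')

theorem split (h : SRuns q (E ++ E') q'') : ∃ q', SRuns q E q' ∧ SRuns q' E' q'' := by
  induction E generalizing q with
  | nil => exact ⟨q, .nil, h⟩
  | cons e t ih =>
    cases h with
    | inv h => obtain ⟨s', h1, h2⟩ := ih h; exact ⟨s', .inv h1, h2⟩
    | res h => obtain ⟨s', h1, h2⟩ := ih h; exact ⟨s', .res h1, h2⟩
    | lin ht h => obtain ⟨s', h1, h2⟩ := ih h; exact ⟨s', .lin ht h1, h2⟩

theorem legal (h : SRuns q E q') : Legal τ q (records E) := by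
  induction h with
  | nil => trivial
  | inv _ ih => exact ih
  | res _ ih => exact ih
  | lin ht _ ih => exact ⟨_, ht, ih⟩

theorem unique (hτ : ∀ q op q1 q2 r, τ.trans q op q1 r → τ.trans q op q2 r → q1 = q2)
    (h : SRuns q E q') (h' : SRuns q E q'') : q' = q'' := by
  induction h with
  | nil => cases h'; rfl
  | inv _ ih => cases h' with | inv h' => exact ih h'
  | res _ ih => cases h' with | res h' => exact ih h'
  | lin ht _ ih =>
    cases h' with
    | lin ht' h' => cases hτ _ _ _ _ _ ht ht'; exact ih h'

end SRuns

/-- The state of a partially constructed linearization: the history `H` can be extended by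
linearization points to a legal trace that leads to the abstract state `A` and to the statuses
`st`. A process `p` whose operation is pending may still be linearized retroactively in every
state of `past p`: the trace passes through this state after the last event of `p`. -/
def LinTrace (H : List (HEvent P τ.Op τ.Resp)) (A : τ.State) (st : P → Status τ.Op τ.Resp)
    (past : P → Set τ.State) : Prop :=
  ∃ E : List (XEvent P τ.Op τ.Resp), visible E = H ∧ SRuns τ.init E A ∧
    (∀ p, Runs p .idle E (st p)) ∧
    ∀ p op, st p = .pend op → ∀ q ∈ past p, ∃ E1 E2, E = E1 ++ E2 ∧ SRuns τ.init E1 q ∧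
      SRuns q E2 A ∧ ∀ e ∈ E2, e.proc ≠ p

namespace LinTrace

variable {H : List (HEvent P τ.Op τ.Resp)} {A A' : τ.State} {st : P → Status τ.Op τ.Resp}
  {past past' : P → Set τ.State} {p : P} {op : τ.Op} {r : τ.Resp}

theorem nil : LinTrace ([] : List (HEvent P τ.Op τ.Resp)) τ.init (fun _ => .idle) past :=
  ⟨[], rfl, .nil, fun _ => .nil, by simp⟩

theorem mono (h : LinTrace H A st past) (hp : ∀ p, past' p ⊆ past p) :
    LinTrace H A st past' := by
  obtain ⟨E, h1, h2, h3, h4⟩ := h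
  exact ⟨E, h1, h2, h3, fun p op hop q hq => h4 p op hop q (hp p hq)⟩

variable [DecidableEq P]

theorem inv (h : LinTrace H A st past) (hp : st p = .idle) (op : τ.Op) :
    LinTrace (H ++ [.inv p op]) A (Function.update st p (.pend op))
      (Function.update past p {A}) := by
  obtain ⟨E, rfl, h2, h3, h4⟩ := h
  refine ⟨E ++ [.inv p op], by simp [visible_append], h2.append (.inv .nil), fun q => ?_, ?_⟩
  · refine (h3 q).append ?_
    by_cases hq : q = p
    · subst hq; rw [hp, Function.update_self]; exact .inv .nil
    · rw [Function.update_of_ne hq]; exact .skip (Ne.symm hq) .nil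
  · intro q op' hop' B hB
    by_cases hq : q = p
    · subst hq
      rw [Function.update_self] at hB
      obtain rfl : B = A := hB
      exact ⟨E ++ [.inv q op], [], by simp, h2.append (.inv .nil), .nil, by simp⟩
    · rw [Function.update_of_ne hq] at hB hop'
      obtain ⟨E1, E2, rfl, h5, h6, h7⟩ := h4 q op' hop' B hB
      refine ⟨E1, E2 ++ [.inv p op], by simp, h5, h6.append (.inv .nil), fun e he => ?_⟩
      rcases List.mem_append.1 he with he | he
      · exact h7 e he
      · rw [List.mem_singleton.1 he]; exact Ne.symm hq

theorem res (h : LinTrace H A st past) (hp : st p = .done r) :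
    LinTrace (H ++ [.res p r]) A (Function.update st p .idle) past := by
  obtain ⟨E, rfl, h2, h3, h4⟩ := h
  refine ⟨E ++ [.res p r], by simp [visible_append], h2.append (.res .nil), fun q => ?_, ?_⟩
  · refine (h3 q).append ?_
    by_cases hq : q = p
    · subst hq; rw [hp, Function.update_self]; exact .res .nil
    · rw [Function.update_of_ne hq]; exact .skip (Ne.symm hq) .nil
  · intro q op' hop' B hB
    by_cases hq : q = p
    · subst hq; simp at hop'
    · rw [Function.update_of_ne hq] at hop'
      obtain ⟨E1, E2, rfl, h5, h6, h7⟩ := h4 q op' hop' B hB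
      refine ⟨E1, E2 ++ [.res p r], by simp, h5, h6.append (.res .nil), fun e he => ?_⟩
      rcases List.mem_append.1 he with he | he
      · exact h7 e he
      · rw [List.mem_singleton.1 he]; exact Ne.symm hq

/-- A pending operation takes effect now. -/
theorem lin (h : LinTrace H A st past) (hp : st p = .pend op) (ht : τ.trans A op A' r) :
    LinTrace H A' (Function.update st p (.done r)) (fun q => insert A' (past q)) := by
  obtain ⟨E, rfl, h2, h3, h4⟩ := h
  have h2' := h2.append (.lin (p := p) ht .nil)
  refine ⟨E ++ [.lin p op r], by simp [visible_append], h2', fun q => ?_, ?_⟩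
  · refine (h3 q).append ?_
    by_cases hq : q = p
    · subst hq; rw [hp, Function.update_self]; exact .lin .nil
    · rw [Function.update_of_ne hq]; exact .skip (Ne.symm hq) .nil
  · intro q op' hop' B hB
    by_cases hq : q = p
    · subst hq; simp at hop'
    · rw [Function.update_of_ne hq] at hop'
      rcases hB with rfl | hB
      · exact ⟨_, [], by simp, h2', .nil, by simp⟩
      obtain ⟨E1, E2, rfl, h5, h6, h7⟩ := h4 q op' hop' B hB
      refine ⟨E1, E2 ++ [.lin p op r], by simp, h5, h6.append (.lin ht .nil), fun e he => ?_⟩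
      rcases List.mem_append.1 he with he | he
      · exact h7 e he
      · rw [List.mem_singleton.1 he]; exact Ne.symm hq

/-- A pending operation that does not change the state `B` takes effect retroactively, at a moment
since its invocation when the state was `B`. -/
theorem lin_past (hτ : ∀ q op q1 q2 r, τ.trans q op q1 r → τ.trans q op q2 r → q1 = q2)
    (h : LinTrace H A st past) (hp : st p = .pend op) {B : τ.State} (hB : B ∈ past p)
    (ht : τ.trans B op B r) :
    LinTrace H A (Function.update st p (.done r)) past := by
  obtain ⟨E, rfl, h2, h3, h4⟩ := h
  obtain ⟨E1, E2, rfl, h5, h6, h7⟩ := h4 p op hp B hB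
  refine ⟨E1 ++ .lin p op r :: E2, by simp [visible_append], h5.append (.lin ht h6),
    fun q => ?_, ?_⟩
  · obtain ⟨s, ha, hb⟩ := (h3 q).split
    by_cases hq : q = p
    · subst hq
      have := hb.eq_of_forall_ne h7
      rw [← this, hp] at ha
      rw [Function.update_self]
      exact ha.append (.lin (.of_forall_ne h7))
    · rw [Function.update_of_ne hq]
      exact ha.append (.skip (Ne.symm hq) hb)
  · intro q op' hop' D hD
    by_cases hq : q = p
    · subst hq; simp at hop'
    · rw [Function.update_of_ne hq] at hop'
      obtain ⟨E1', E2', heq, h5', h6', h7'⟩ := h4 q op' hop' D hD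
      rcases List.append_eq_append_iff.1 heq with ⟨X, rfl, rfl⟩ | ⟨X, rfl, rfl⟩
      · obtain ⟨B', hB1, hB2⟩ := h5'.split
        obtain rfl := hB1.unique hτ h5
        exact ⟨E1 ++ .lin p op r :: X, E2', by simp, h5.append (.lin ht hB2), h6', h7'⟩
      · obtain ⟨B', hB1, hB2⟩ := h5.split
        obtain rfl := hB1.unique hτ h5'
        refine ⟨E1', X ++ .lin p op r :: E2, by simp, h5', hB2.append (.lin ht h6), ?_⟩
        intro e he
        simp only [List.mem_append, List.mem_cons] at he h7'
        rcases he with he | rfl | he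
        · exact h7' e (.inl he)
        · exact Ne.symm hq
        · exact h7' e (.inr he)

/-- Responses for the operations of the processes in `l` that have been linearized. -/
def finishing (st : P → Status τ.Op τ.Resp) (l : List P) : List (P × τ.Resp) :=
  l.filterMap fun p =>
    match st p with
    | .done r => some (p, r)
    | _ => none

theorem runs_finishing (st : P → Status τ.Op τ.Resp) (p : P) (l : List P) (hl : l.Nodup) :
    ∃ s, Runs p (st p) ((finishing st l).map fun x => XEvent.res x.1 x.2) s ∧
      (p ∈ l → ∀ r, s ≠ .done r) ∧ (p ∉ l → s = st p) := by
  induction l with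
  | nil => exact ⟨st p, .nil, by simp, by simp⟩
  | cons a l ih =>
    obtain ⟨s, h1, h2, h3⟩ := ih hl.of_cons
    have ha : a ∉ l := (List.nodup_cons.1 hl).1
    by_cases hap : a = p
    · subst hap
      obtain rfl := h3 ha
      have hE : ∀ e ∈ (finishing st l).map fun x => (XEvent.res x.1 x.2 : XEvent P τ.Op τ.Resp),
          e.proc ≠ a := by
        intro e he
        simp only [finishing, List.mem_map, List.mem_filterMap] at he
        obtain ⟨x, ⟨b, hb, hx⟩, rfl⟩ := he
        cases hst : st b with
        | done r =>
          simp only [hst, Option.some.injEq] at hx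
          subst hx
          rintro rfl
          exact ha hb
        | _ => simp [hst] at hx
      cases hst : st a with
      | done r =>
        refine ⟨.idle, ?_, by simp, by simp⟩
        simp only [finishing, List.filterMap_cons, hst, List.map_cons]
        exact .res (.of_forall_ne hE)
      | _ =>
        refine ⟨st a, ?_, by simp [hst], by simp⟩
        simp only [finishing, List.filterMap_cons, hst]
        exact .of_forall_ne hE
    · refine ⟨s, ?_, by simpa [Ne.symm hap] using h2, by simpa [Ne.symm hap] using h3⟩
      cases hst : st a with
      | done r =>
        simp only [finishing, List.filterMap_cons, hst, List.map_cons]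
        exact .skip hap h1
      | _ =>
        simp only [finishing, List.filterMap_cons, hst]
        exact h1

/-- To complete the history, the linearized operations return, and the other incomplete operations
are dropped. -/
theorem linearizable [Fintype P] (h : LinTrace H A st past) : Linearizable τ H := by
  obtain ⟨E, rfl, h2, h3, -⟩ := h
  set R := finishing st Finset.univ.toList
  set E' : List (XEvent P τ.Op τ.Resp) := E ++ R.map fun x => .res x.1 x.2 with hE'
  have hvis : visible E' = visible E ++ R.map fun x => HEvent.res x.1 x.2 := by
    rw [hE', visible_append]
    congr 1
    induction R with
    | nil => rfl
    | cons x R ih => simp [ih]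
  have hrec : records E' = records E := by
    have : ∀ R : List (P × τ.Resp),
        records (R.map fun x => (XEvent.res x.1 x.2 : XEvent P τ.Op τ.Resp)) = [] := by
      intro R
      induction R with
      | nil => rfl
      | cons x R ih => simp [ih]
    rw [hE', records_append, this, List.append_nil]
  have hruns : ∀ p, ∃ s, Runs p .idle E' s ∧ ∀ r, s ≠ .done r := by
    intro p
    obtain ⟨s, ha, hb, -⟩ := runs_finishing st p _ (Finset.nodup_toList Finset.univ)
    exact ⟨s, (h3 p).append ha, hb (by simp)⟩
  choose s hs hs' using hruns
  have hd : ∀ p, Runs p .idle (dropPending E') .idle := fun p =>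
    (hs p).dropPending (hs' p) (.inl rfl)
  refine ⟨_, ⟨R, ?_, rfl⟩, ?_⟩
  · rw [← hvis]; exact Runs.wellFormed hs
  · rw [← hvis, ← visible_dropPending]
    refine ⟨records (dropPending E'), fun p => (hd p).proj_eq,
      fun o o' h => precedes_seqHistory hd h, ?_⟩
    rw [records_dropPending, hrec]
    exact h2.legal

end LinTrace

end LinTrace

/-! ### Snapshots of the list -/

/-- The shared memory together with the set of the nodes that are on the chain from `head` to
`tail`; a node is on the chain from the step that links it to the step that unlinks it. -/
structure Snap (n : ℕ) where
  mem : Heap n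
  nodes : Set (Ref n)

variable {n : ℕ}

theorem key_inj {v w : ℤ} : key v = key w ↔ v = w := by simp [key]

theorem key_lt_top (v : ℤ) : key v < ⊤ := by
  rw [key, ← WithBot.coe_top, WithBot.coe_lt_coe]; exact WithTop.coe_lt_top v

theorem bot_lt_key (v : ℤ) : ⊥ < key v := WithBot.bot_lt_coe _

namespace Snap

/-- The abstract set: the values of the nodes on the chain that are not marked as deleted. -/
def keys (s : Snap n) : Set ℤ :=
  {v | ∃ a ∈ s.nodes, (s.mem a).val = key v ∧ (s.mem a).deleted = false}

/-- The node has been linked into the list at some time. -/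
def Published (s : Snap n) (a : Ref n) : Prop := a ∈ s.nodes ∨ (s.mem a).deleted = true

/-- The nodes on the chain form a list that is sorted by strictly increasing values. This is
expressed without reference to paths: no value of a node on the chain lies strictly between the
values of a node and its successor. -/
structure Sorted (s : Snap n) : Prop where
  head_mem : .head ∈ s.nodes
  tail_mem : .tail ∈ s.nodes
  val_head : (s.mem .head).val = ⊥
  val_tail : (s.mem .tail).val = ⊤
  inj : ∀ a ∈ s.nodes, ∀ b ∈ s.nodes, (s.mem a).val = (s.mem b).val → a = b
  next_mem : ∀ a ∈ s.nodes, a ≠ .tail → (s.mem a).next ∈ s.nodes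
  lt_next : ∀ a ∈ s.nodes, a ≠ .tail → (s.mem a).val < (s.mem (s.mem a).next).val
  next_le : ∀ a ∈ s.nodes, a ≠ .tail → ∀ b ∈ s.nodes, (s.mem a).val < (s.mem b).val →
    (s.mem (s.mem a).next).val ≤ (s.mem b).val

namespace Sorted

variable {s : Snap n} {a b : Ref n} {v : ℤ}

theorem ne_tail_of_lt (h : s.Sorted) {x : Key} (ha : (s.mem a).val < x) : a ≠ .tail := by
  rintro rfl
  rw [h.val_tail] at ha
  exact not_top_lt ha

theorem ne_tail_of_eq (h : s.Sorted) (ha : (s.mem a).val = key v) : a ≠ .tail := by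
  rintro rfl
  rw [h.val_tail] at ha
  exact (key_lt_top v).ne' ha

theorem ne_head_of_eq (h : s.Sorted) (ha : (s.mem a).val = key v) : a ≠ .head := by
  rintro rfl
  rw [h.val_head] at ha
  exact (bot_lt_key v).ne ha

/-- A node on the chain has only one predecessor. -/
theorem next_inj (h : s.Sorted) (ha : a ∈ s.nodes) (hb : b ∈ s.nodes) (hat : a ≠ .tail)
    (hbt : b ≠ .tail) (hab : (s.mem a).next = (s.mem b).next) : a = b := by
  refine h.inj a ha b hb (le_antisymm ?_ ?_)
  · by_contra! hlt
    have := h.next_le b hb hbt a ha hlt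
    rw [← hab] at this
    exact absurd (h.lt_next a ha hat) (not_lt.2 this)
  · by_contra! hlt
    have := h.next_le a ha hat b hb hlt
    rw [hab] at this
    exact absurd (h.lt_next b hb hbt) (not_lt.2 this)

/-- A value strictly between the values of two adjacent nodes is not in the set. -/
theorem not_mem_keys_of_between (h : s.Sorted) (ha : a ∈ s.nodes) (hav : (s.mem a).val < key v)
    (hv : key v < (s.mem (s.mem a).next).val) : v ∉ s.keys := by
  rintro ⟨b, hb, hbv, -⟩
  have := h.next_le a ha (h.ne_tail_of_lt hav) b hb (hbv ▸ hav)
  exact absurd hv (not_lt.2 (hbv ▸ this))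

/-- Since values on the chain are unique, the value of a marked node is not in the set. -/
theorem not_mem_keys_of_deleted (h : s.Sorted) (ha : a ∈ s.nodes) (hav : (s.mem a).val = key v)
    (hd : (s.mem a).deleted = true) : v ∉ s.keys := by
  rintro ⟨b, hb, hbv, hbd⟩
  obtain rfl := h.inj a ha b hb (hav.trans hbv.symm)
  simp_all

theorem congr {t : Snap n} (h : s.Sorted) (hn : t.nodes = s.nodes)
    (hm : ∀ a ∈ s.nodes, (t.mem a).val = (s.mem a).val ∧ (t.mem a).next = (s.mem a).next) :
    t.Sorted where
  head_mem := hn ▸ h.head_mem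
  tail_mem := hn ▸ h.tail_mem
  val_head := by rw [(hm _ h.head_mem).1, h.val_head]
  val_tail := by rw [(hm _ h.tail_mem).1, h.val_tail]
  inj a ha b hb hab := by
    rw [hn] at ha hb
    rw [(hm a ha).1, (hm b hb).1] at hab
    exact h.inj a ha b hb hab
  next_mem a ha hat := by
    rw [hn] at ha ⊢
    rw [(hm a ha).2]
    exact h.next_mem a ha hat
  lt_next a ha hat := by
    rw [hn] at ha
    rw [(hm a ha).2, (hm a ha).1, (hm _ (h.next_mem a ha hat)).1]
    exact h.lt_next a ha hat
  next_le a ha hat b hb hab := by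
    rw [hn] at ha hb
    rw [(hm a ha).1, (hm b hb).1] at hab
    rw [(hm a ha).2, (hm b hb).1, (hm _ (h.next_mem a ha hat)).1]
    exact h.next_le a ha hat b hb hab

end Sorted

end Snap

/-! ### Interference -/

/-- What holds for every step of the algorithm from snapshot `s` to snapshot `t`. In particular, a
node that is off the chain after the step keeps its successor and its mark: nodes are marked before
they are unlinked, and at most their locks change afterwards. -/
structure Evolves (s t : Snap n) : Prop where
  sorted : t.Sorted
  published : ∀ a, s.Published a → t.Published a
  val : ∀ a, s.Published a → (t.mem a).val = (s.mem a).val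
  vlock : ∀ a, (s.mem a).vlock ≤ (t.mem a).vlock
  off : ∀ a, s.Published a → a ∉ t.nodes →
    (t.mem a).next = (s.mem a).next ∧ (t.mem a).deleted = (s.mem a).deleted

theorem Evolves.refl {s : Snap n} (h : s.Sorted) : Evolves s s where
  sorted := h
  published _ := id
  val _ _ := rfl
  vlock _ := le_rfl
  off _ _ _ := ⟨rfl, rfl⟩

/-- What process `p`, which holds the locks of the nodes in `H`, may assume about a step from `s`
to `t` of another process. A node is protected from changes by others if `p` holds its lock, and it
has not been changed if its version is even and the same before and after the step; the mark
of the successor is protected as well. The nodes which `p` has allocated and not yet linked are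
private. -/
structure Undisturbed (p : Fin n) (H : Ref n → Prop) (s t : Snap n) : Prop where
  held : ∀ a, H a → (t.mem a).vlock = (s.mem a).vlock
  quiet : ∀ a ∈ s.nodes, a ≠ .tail →
    (H a ∨ Even (s.mem a).vlock ∧ (t.mem a).vlock = (s.mem a).vlock) →
    (t.mem a).next = (s.mem a).next ∧ a ∈ t.nodes ∧
      (t.mem (s.mem a).next).deleted = (s.mem (s.mem a).next).deleted
  own : ∀ k, ¬ s.Published (.new p k) →
    t.mem (.new p k) = s.mem (.new p k) ∧ ¬ t.Published (.new p k)

theorem Undisturbed.refl (p : Fin n) (H : Ref n → Prop) (s : Snap n) : Undisturbed p H s s where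
  held _ _ := rfl
  quiet _ ha _ _ := ⟨rfl, ha, rfl⟩
  own _ h := ⟨rfl, h⟩

/-! ### Hindsight -/

/-- `S` is the set of the snapshots since the invocation of the operation in progress at some
process, `s` is the current one. The last clause is the key to retroactive linearization: a node
that was on the chain at some time and no longer is was last on the chain with its final
successor and its mark. -/
structure Hindsight (S : Set (Snap n)) (s : Snap n) : Prop where
  now : s ∈ S
  sorted : ∀ t ∈ S, t.Sorted
  published : ∀ t ∈ S, ∀ a ∈ t.nodes, s.Published a
  val : ∀ t ∈ S, ∀ a ∈ t.nodes, (t.mem a).val = (s.mem a).val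
  last : ∀ t ∈ S, ∀ a ∈ t.nodes, a ∉ s.nodes →
    ∃ u ∈ S, a ∈ u.nodes ∧ (u.mem a).next = (s.mem a).next ∧ (u.mem a).deleted = true

/-- The node was on the chain in some snapshot of `S`. -/
def Seen (S : Set (Snap n)) (a : Ref n) : Prop := ∃ t ∈ S, a ∈ t.nodes

/-- The value `v` was absent from the set in some snapshot of `S`. -/
def Absent (S : Set (Snap n)) (v : ℤ) : Prop := ∃ t ∈ S, v ∉ t.keys

/-- The value `v` was in the set in some snapshot of `S`. -/
def Present (S : Set (Snap n)) (v : ℤ) : Prop := ∃ t ∈ S, v ∈ t.keys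

section

variable {S T : Set (Snap n)} {s : Snap n} {a : Ref n} {v : ℤ}

theorem Seen.mono (h : Seen S a) (hST : S ⊆ T) : Seen T a :=
  let ⟨t, ht, ha⟩ := h; ⟨t, hST ht, ha⟩

theorem Absent.mono (h : Absent S v) (hST : S ⊆ T) : Absent T v :=
  let ⟨t, ht, ha⟩ := h; ⟨t, hST ht, ha⟩

theorem Present.mono (h : Present S v) (hST : S ⊆ T) : Present T v :=
  let ⟨t, ht, ha⟩ := h; ⟨t, hST ht, ha⟩

namespace Hindsight

theorem singleton (hs : s.Sorted) : Hindsight {s} s where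
  now := rfl
  sorted := by rintro t rfl; exact hs
  published := by rintro t rfl a ha; exact .inl ha
  val := by rintro t rfl a _; rfl
  last := by rintro t rfl a ha hn; exact absurd ha hn

theorem published_of_seen (h : Hindsight S s) (ha : Seen S a) : s.Published a :=
  let ⟨t, ht, ha⟩ := ha; h.published t ht a ha

theorem mem_of_seen (h : Hindsight S s) (ha : Seen S a) (hd : (s.mem a).deleted = false) :
    a ∈ s.nodes :=
  (h.published_of_seen ha).resolve_right (by simp [hd])

theorem seen_of_mem (h : Hindsight S s) (ha : a ∈ s.nodes) : Seen S a := ⟨s, h.now, ha⟩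

/-- If the current successor of a node is read, then this link was on the chain at some time. -/
theorem exists_link (h : Hindsight S s) (ha : Seen S a) :
    ∃ u ∈ S, a ∈ u.nodes ∧ (u.mem a).next = (s.mem a).next := by
  by_cases hn : a ∈ s.nodes
  · exact ⟨s, h.now, hn, rfl⟩
  · obtain ⟨t, ht, ha⟩ := ha
    obtain ⟨u, hu, h1, h2, -⟩ := h.last t ht a ha hn
    exact ⟨u, hu, h1, h2⟩

theorem seen_next (h : Hindsight S s) (ha : Seen S a) (hav : (s.mem a).val < key v) :
    Seen S (s.mem a).next ∧ (key v < (s.mem (s.mem a).next).val → Absent S v) := by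
  obtain ⟨u, hu, h1, h2⟩ := h.exists_link ha
  have hval := h.val u hu a h1
  rw [← hval] at hav
  have hs := h.sorted u hu
  have hmem := hs.next_mem a h1 (hs.ne_tail_of_lt hav)
  rw [← h2]
  refine ⟨⟨u, hu, hmem⟩, fun hv => ⟨u, hu, ?_⟩⟩
  rw [← h.val u hu _ hmem] at hv
  exact hs.not_mem_keys_of_between h1 hav hv

/-- If a node is found to be marked, then its value was absent at some time since it was
encountered. -/
theorem absent_of_deleted (h : Hindsight S s) (ha : Seen S a) (hav : (s.mem a).val = key v)
    (hd : (s.mem a).deleted = true) : Absent S v := by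
  by_cases hn : a ∈ s.nodes
  · exact ⟨s, h.now, (h.sorted s h.now).not_mem_keys_of_deleted hn hav hd⟩
  · obtain ⟨t, ht, ha⟩ := ha
    obtain ⟨u, hu, h1, -, h3⟩ := h.last t ht a ha hn
    exact ⟨u, hu, (h.sorted u hu).not_mem_keys_of_deleted h1 ((h.val u hu a h1).trans hav) h3⟩

theorem present_of_not_deleted (h : Hindsight S s) (ha : Seen S a)
    (hav : (s.mem a).val = key v) (hd : (s.mem a).deleted = false) : Present S v :=
  ⟨s, h.now, a, h.mem_of_seen ha hd, hav, hd⟩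

theorem insert {t : Snap n} (h : Hindsight S s) (hE : Evolves s t) :
    Hindsight (insert t S) t where
  now := .inl rfl
  sorted := by
    rintro u (rfl | hu)
    · exact hE.sorted
    · exact h.sorted u hu
  published := by
    rintro u (rfl | hu) a ha
    · exact .inl ha
    · exact hE.published a (h.published u hu a ha)
  val := by
    rintro u (rfl | hu) a ha
    · rfl
    · rw [h.val u hu a ha, hE.val a (h.published u hu a ha)]
  last := by
    rintro u (rfl | hu) a ha hn
    · exact absurd ha hn
    · have hp := h.published u hu a ha
      obtain ⟨h1, h2⟩ := hE.off a hp hn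
      by_cases has : a ∈ s.nodes
      · refine ⟨s, .inr h.now, has, h1.symm, ?_⟩
        rw [← h2]
        exact (hE.published a hp).resolve_left hn
      · obtain ⟨w, hw, h3, h4, h5⟩ := h.last u hu a ha has
        exact ⟨w, .inr hw, h3, h4.trans h1.symm, h5⟩

end Hindsight

end

/-! ### Invariants of the control states -/

/-- Process in control state `pc` holds the lock of the node. -/
def Holds : PC n → Ref n → Prop
  | .insLink prev _, a => a = prev
  | .remSpinVer prev _, a => a = prev
  | .remSpinLock prev _ _, a => a = prev
  | .remMark prev curr, a => a = prev ∨ a = curr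
  | .remReadNext prev curr, a => a = prev ∨ a = curr
  | .remUnlink prev curr _, a => a = prev ∨ a = curr
  | .remUnlockRead prev curr, a => a = prev ∨ a = curr
  | .remUnlockCas prev curr _, a => a = prev ∨ a = curr
  | .unlockRead prev, a => a = prev
  | .unlockCas prev _, a => a = prev
  | _, _ => False

/-- The update operation with argument `v`. -/
def Upd.op : Upd → ℤ → SetOp
  | .ins, v => .insert v
  | .rem, v => .remove v

/-- A node encountered in the search for `v` whose value has not been compared with `v` yet. -/
def Reached (S : Set (Snap n)) (s : Snap n) (v : ℤ) (a : Ref n) : Prop :=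
  Seen S a ∧ (key v < (s.mem a).val → Absent S v)

/-- A node encountered in the search for `v` whose value is less than `v`. -/
def Before (S : Set (Snap n)) (s : Snap n) (v : ℤ) (a : Ref n) : Prop :=
  Seen S a ∧ (s.mem a).val < key v

/-- `ver` is an unlocked version of the node's lock, not later than the current one. -/
def VersionRead (s : Snap n) (a : Ref n) (ver : ℕ) : Prop := Even ver ∧ ver ≤ (s.mem a).vlock

/-- If the lock of `a` is still at version `ver`, then `a` is on the chain with successor `b`. -/
def LinkedAt (s : Snap n) (a : Ref n) (ver : ℕ) (b : Ref n) : Prop :=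
  (s.mem a).vlock = ver → a ∈ s.nodes ∧ (s.mem a).next = b

/-- The node has been allocated by `p` for value `v`, and it has not been linked yet. -/
def Private (s : Snap n) (p : Fin n) (allocs : ℕ) (v : ℤ) (a : Ref n) : Prop :=
  (∃ k < allocs, a = .new p k) ∧ ¬ s.Published a ∧ (s.mem a).val = key v

/-- The node `curr` with value `v` and mark `d` is the successor of `prev` on the chain. -/
structure Removing (s : Snap n) (v : ℤ) (prev curr : Ref n) (d : Bool) : Prop where
  mem : prev ∈ s.nodes
  next : (s.mem prev).next = curr
  lt : (s.mem prev).val < key v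
  val : (s.mem curr).val = key v
  deleted : (s.mem curr).deleted = d

/-- The invariant of a process `p` with local state `l` and status `st`, where `s` is the
current snapshot and `S` contains the snapshots since the last invocation by `p`. Successful
`insert`s and `remove`s are linearized when they write `prev.next` and `curr.deleted`, all other
operations (retroactively) when they are about to return. -/
def PCInv (s : Snap n) (S : Set (Snap n)) (p : Fin n) (l : Local n) (st : Status SetOp Bool) :
    Prop :=
  match l.pc with
  | .idle => st = .idle
  | .ret b => st = .done b
  | .containsTest v curr => st = .pend (.contains v) ∧ Reached S s v curr
  | .containsNext v curr => st = .pend (.contains v) ∧ Before S s v curr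
  | .containsVal v curr => st = .pend (.contains v) ∧ Reached S s v curr ∧
      key v ≤ (s.mem curr).val
  | .containsDel v curr => st = .pend (.contains v) ∧ Seen S curr ∧ (s.mem curr).val = key v
  | .travTest u v prev curr => st = .pend (u.op v) ∧ Before S s v prev ∧ Reached S s v curr
  | .travNext u v curr => st = .pend (u.op v) ∧ Before S s v curr
  | .valStart u v prev => st = .pend (u.op v) ∧ Before S s v prev
  | .valPrevDel u v prev pVer => st = .pend (u.op v) ∧ Before S s v prev ∧
      VersionRead s prev pVer
  | .valNext u v prev pVer => st = .pend (u.op v) ∧ Before S s v prev ∧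
      VersionRead s prev pVer ∧ LinkedAt s prev pVer (s.mem prev).next
  | .valTest u v prev pVer curr => st = .pend (u.op v) ∧ Before S s v prev ∧
      VersionRead s prev pVer ∧ LinkedAt s prev pVer curr ∧ Reached S s v curr
  | .valCurrVer u v prev curr => st = .pend (u.op v) ∧ Before S s v prev ∧ Before S s v curr
  | .valCurrDel u v prev pVer curr => st = .pend (u.op v) ∧ Before S s v prev ∧
      Before S s v curr ∧ VersionRead s curr pVer
  | .insDel v prev pVer curr => st = .pend (.insert v) ∧ Before S s v prev ∧
      VersionRead s prev pVer ∧ LinkedAt s prev pVer curr ∧ Seen S curr ∧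
      key v ≤ (s.mem curr).val
  | .insVal v prev pVer curr => st = .pend (.insert v) ∧ Before S s v prev ∧
      VersionRead s prev pVer ∧ LinkedAt s prev pVer curr ∧ Seen S curr ∧
      key v ≤ (s.mem curr).val ∧ ((s.mem curr).val = key v → Present S v)
  | .insNewVal v prev pVer curr => st = .pend (.insert v) ∧ Before S s v prev ∧
      VersionRead s prev pVer ∧ LinkedAt s prev pVer curr ∧ Seen S curr ∧
      key v < (s.mem curr).val
  | .insNewNext v prev pVer curr newNode => st = .pend (.insert v) ∧ Before S s v prev ∧
      VersionRead s prev pVer ∧ LinkedAt s prev pVer curr ∧ Seen S curr ∧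
      key v < (s.mem curr).val ∧ Private s p l.allocs v newNode
  | .insLock v prev pVer newNode => ∃ curr, st = .pend (.insert v) ∧ Before S s v prev ∧
      VersionRead s prev pVer ∧ LinkedAt s prev pVer curr ∧ Seen S curr ∧
      key v < (s.mem curr).val ∧ Private s p l.allocs v newNode ∧ (s.mem newNode).next = curr
  | .insLink prev newNode => ∃ v curr, st = .pend (.insert v) ∧ Before S s v prev ∧
      prev ∈ s.nodes ∧ (s.mem prev).next = curr ∧ Seen S curr ∧
      key v < (s.mem curr).val ∧ Private s p l.allocs v newNode ∧ (s.mem newNode).next = curr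
  | .remVal v prev pVer curr => st = .pend (.remove v) ∧ Before S s v prev ∧
      VersionRead s prev pVer ∧ LinkedAt s prev pVer curr ∧ Reached S s v curr ∧
      key v ≤ (s.mem curr).val
  | .remDel v prev pVer curr => st = .pend (.remove v) ∧ Before S s v prev ∧
      VersionRead s prev pVer ∧ LinkedAt s prev pVer curr ∧ Seen S curr ∧
      (s.mem curr).val = key v
  | .remLock v prev pVer curr => st = .pend (.remove v) ∧ Before S s v prev ∧
      VersionRead s prev pVer ∧ Seen S curr ∧ (s.mem curr).val = key v ∧
      ((s.mem prev).vlock = pVer → Removing s v prev curr false)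
  | .remSpinVer prev curr => ∃ v, st = .pend (.remove v) ∧ Removing s v prev curr false
  | .remSpinLock prev curr ver => ∃ v, st = .pend (.remove v) ∧ Removing s v prev curr false ∧
      Even ver
  | .remMark prev curr => ∃ v, st = .pend (.remove v) ∧ Removing s v prev curr false
  | .remReadNext prev curr => ∃ v, st = .done true ∧ Removing s v prev curr true
  | .remUnlink prev curr nxt => ∃ v, st = .done true ∧ Removing s v prev curr true ∧
      (s.mem curr).next = nxt
  | .remUnlockRead prev curr => st = .done true ∧ s.Published prev ∧ s.Published curr ∧
      prev ≠ curr
  | .remUnlockCas prev curr x => st = .done true ∧ s.Published prev ∧ s.Published curr ∧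
      prev ≠ curr ∧ x = (s.mem curr).vlock
  | .unlockRead prev => st = .done true ∧ s.Published prev
  | .unlockCas prev x => st = .done true ∧ s.Published prev ∧ x = (s.mem prev).vlock

/-! ### Stability of the invariants under steps of other processes -/

section Stability

variable {S : Set (Snap n)} {s t : Snap n} {p : Fin n} {H : Ref n → Prop} {a b : Ref n} {v : ℤ}
  {ver allocs : ℕ}

theorem Seen.insert (h : Seen S a) : Seen (insert t S) a := h.mono (Set.subset_insert _ _)

theorem Present.insert (h : Present S v) : Present (insert t S) v :=
  Present.mono h (Set.subset_insert _ _)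

theorem Hindsight.val_eq (hS : Hindsight S s) (hE : Evolves s t) (h : Seen S a) :
    (t.mem a).val = (s.mem a).val := hE.val a (hS.published_of_seen h)

theorem Reached.step (h : Reached S s v a) (hS : Hindsight S s) (hE : Evolves s t) :
    Reached (Insert.insert t S) t v a := by
  refine ⟨h.1.insert, fun hv => ?_⟩
  rw [hS.val_eq hE h.1] at hv
  exact (h.2 hv).mono (Set.subset_insert _ _)

theorem Before.step (h : Before S s v a) (hS : Hindsight S s) (hE : Evolves s t) :
    Before (Insert.insert t S) t v a := by
  refine ⟨h.1.insert, ?_⟩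
  rw [hS.val_eq hE h.1]
  exact h.2

theorem Before.ne_tail (h : Before S s v a) (hS : Hindsight S s) : a ≠ .tail :=
  (hS.sorted s hS.now).ne_tail_of_lt h.2

theorem VersionRead.step (h : VersionRead s a ver) (hE : Evolves s t) : VersionRead t a ver :=
  ⟨h.1, h.2.trans (hE.vlock a)⟩

theorem VersionRead.vlock_eq (h : VersionRead s a ver) (hE : Evolves s t)
    (ht : (t.mem a).vlock = ver) : (s.mem a).vlock = ver :=
  le_antisymm ((hE.vlock a).trans ht.le) h.2

theorem LinkedAt.step (h : LinkedAt s a ver b) (hE : Evolves s t) (hU : Undisturbed p H s t)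
    (hv : VersionRead s a ver) (hat : a ≠ .tail) : LinkedAt t a ver b := by
  intro ht
  have hs := hv.vlock_eq hE ht
  obtain ⟨h1, h2⟩ := h hs
  obtain ⟨h3, h4, -⟩ := hU.quiet a h1 hat (.inr ⟨hs ▸ hv.1, ht.trans hs.symm⟩)
  exact ⟨h4, h3.trans h2⟩

theorem Private.step (h : Private s p allocs v a) (hU : Undisturbed p H s t) :
    Private t p allocs v a ∧ t.mem a = s.mem a := by
  obtain ⟨⟨k, hk, rfl⟩, h1, h2⟩ := h
  obtain ⟨h3, h4⟩ := hU.own k h1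
  exact ⟨⟨⟨k, hk, rfl⟩, h4, by rw [h3, h2]⟩, h3⟩

theorem Removing.step {d : Bool} (h : Removing s v a b d) (hs : s.Sorted) (hE : Evolves s t)
    (hU : Undisturbed p H s t)
    (ha : H a ∨ Even (s.mem a).vlock ∧ (t.mem a).vlock = (s.mem a).vlock) :
    Removing t v a b d := by
  have hat := hs.ne_tail_of_lt h.lt
  obtain ⟨h1, h2, h3⟩ := hU.quiet a h.mem hat ha
  refine ⟨h2, h1.trans h.next, ?_, ?_, ?_⟩
  · rw [hE.val a (.inl h.mem)]; exact h.lt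
  · rw [hE.val b (.inl (h.next ▸ hs.next_mem a h.mem hat))]; exact h.val
  · rw [h.next] at h3; rw [h3]; exact h.deleted

theorem Removing.mem_curr {d : Bool} (h : Removing s v a b d) (hs : s.Sorted) : b ∈ s.nodes :=
  h.next ▸ hs.next_mem a h.mem (hs.ne_tail_of_lt h.lt)

theorem Removing.ne {d : Bool} (h : Removing s v a b d) : a ≠ b := by
  rintro rfl
  exact h.lt.ne h.val

theorem PCInv.stable {l : Local n} {st : Status SetOp Bool} (h : PCInv s S p l st)
    (hS : Hindsight S s) (hE : Evolves s t) (hU : Undisturbed p (Holds l.pc) s t) :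
    PCInv t (insert t S) p l st := by
  obtain ⟨pc, allocs⟩ := l
  have hs := hS.sorted s hS.now
  cases pc with
  | idle => exact h
  | ret b => exact h
  | containsTest v curr => exact ⟨h.1, h.2.step hS hE⟩
  | containsNext v curr => exact ⟨h.1, h.2.step hS hE⟩
  | containsVal v curr =>
    obtain ⟨h1, h2, h3⟩ := h
    exact ⟨h1, h2.step hS hE, by rwa [hS.val_eq hE h2.1]⟩
  | containsDel v curr =>
    obtain ⟨h1, h2, h3⟩ := h
    exact ⟨h1, h2.insert, by rwa [hS.val_eq hE h2]⟩
  | travTest u v prev curr => exact ⟨h.1, h.2.1.step hS hE, h.2.2.step hS hE⟩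
  | travNext u v curr => exact ⟨h.1, h.2.step hS hE⟩
  | valStart u v prev => exact ⟨h.1, h.2.step hS hE⟩
  | valPrevDel u v prev pVer => exact ⟨h.1, h.2.1.step hS hE, h.2.2.step hE⟩
  | valNext u v prev pVer =>
    obtain ⟨h1, h2, h3, h4⟩ := h
    exact ⟨h1, h2.step hS hE, h3.step hE,
      fun hv => ⟨(h4.step hE hU h3 (h2.ne_tail hS) hv).1, rfl⟩⟩
  | valTest u v prev pVer curr =>
    obtain ⟨h1, h2, h3, h4, h5⟩ := h
    exact ⟨h1, h2.step hS hE, h3.step hE, h4.step hE hU h3 (h2.ne_tail hS), h5.step hS hE⟩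
  | valCurrVer u v prev curr => exact ⟨h.1, h.2.1.step hS hE, h.2.2.step hS hE⟩
  | valCurrDel u v prev pVer curr =>
    obtain ⟨h1, h2, h3, h4⟩ := h
    exact ⟨h1, h2.step hS hE, h3.step hS hE, h4.step hE⟩
  | insDel v prev pVer curr =>
    obtain ⟨h1, h2, h3, h4, h5, h6⟩ := h
    exact ⟨h1, h2.step hS hE, h3.step hE, h4.step hE hU h3 (h2.ne_tail hS), h5.insert,
      by rwa [hS.val_eq hE h5]⟩
  | insVal v prev pVer curr =>
    obtain ⟨h1, h2, h3, h4, h5, h6, h7⟩ := h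
    exact ⟨h1, h2.step hS hE, h3.step hE, h4.step hE hU h3 (h2.ne_tail hS), h5.insert,
      by rwa [hS.val_eq hE h5], fun hv => (h7 (by rwa [hS.val_eq hE h5] at hv)).insert⟩
  | insNewVal v prev pVer curr =>
    obtain ⟨h1, h2, h3, h4, h5, h6⟩ := h
    exact ⟨h1, h2.step hS hE, h3.step hE, h4.step hE hU h3 (h2.ne_tail hS), h5.insert,
      by rwa [hS.val_eq hE h5]⟩
  | insNewNext v prev pVer curr newNode =>
    obtain ⟨h1, h2, h3, h4, h5, h6, h7⟩ := h
    exact ⟨h1, h2.step hS hE, h3.step hE, h4.step hE hU h3 (h2.ne_tail hS), h5.insert,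
      by rwa [hS.val_eq hE h5], (h7.step hU).1⟩
  | insLock v prev pVer newNode =>
    obtain ⟨curr, h1, h2, h3, h4, h5, h6, h7, h8⟩ := h
    exact ⟨curr, h1, h2.step hS hE, h3.step hE, h4.step hE hU h3 (h2.ne_tail hS), h5.insert,
      by rwa [hS.val_eq hE h5], (h7.step hU).1, by rwa [(h7.step hU).2]⟩
  | insLink prev newNode =>
    obtain ⟨v, curr, h1, h2, h3, h4, h5, h6, h7, h8⟩ := h
    obtain ⟨h9, h10, -⟩ := hU.quiet prev h3 (h2.ne_tail hS) (.inl rfl)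
    exact ⟨v, curr, h1, h2.step hS hE, h10, h9.trans h4, h5.insert,
      by rwa [hS.val_eq hE h5], (h7.step hU).1, by rwa [(h7.step hU).2]⟩
  | remVal v prev pVer curr =>
    obtain ⟨h1, h2, h3, h4, h5, h6⟩ := h
    exact ⟨h1, h2.step hS hE, h3.step hE, h4.step hE hU h3 (h2.ne_tail hS), h5.step hS hE,
      by rwa [hS.val_eq hE h5.1]⟩
  | remDel v prev pVer curr =>
    obtain ⟨h1, h2, h3, h4, h5, h6⟩ := h
    exact ⟨h1, h2.step hS hE, h3.step hE, h4.step hE hU h3 (h2.ne_tail hS), h5.insert,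
      by rwa [hS.val_eq hE h5]⟩
  | remLock v prev pVer curr =>
    obtain ⟨h1, h2, h3, h4, h5, h6⟩ := h
    refine ⟨h1, h2.step hS hE, h3.step hE, h4.insert, by rwa [hS.val_eq hE h4], fun hv => ?_⟩
    have hv' := h3.vlock_eq hE hv
    exact (h6 hv').step hs hE hU (.inr ⟨hv' ▸ h3.1, hv.trans hv'.symm⟩)
  | remSpinVer prev curr =>
    obtain ⟨v, h1, h2⟩ := h
    exact ⟨v, h1, h2.step hs hE hU (.inl rfl)⟩
  | remSpinLock prev curr ver =>
    obtain ⟨v, h1, h2, h3⟩ := h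
    exact ⟨v, h1, h2.step hs hE hU (.inl rfl), h3⟩
  | remMark prev curr =>
    obtain ⟨v, h1, h2⟩ := h
    exact ⟨v, h1, h2.step hs hE hU (.inl (.inl rfl))⟩
  | remReadNext prev curr =>
    obtain ⟨v, h1, h2⟩ := h
    exact ⟨v, h1, h2.step hs hE hU (.inl (.inl rfl))⟩
  | remUnlink prev curr nxt =>
    obtain ⟨v, h1, h2, h3⟩ := h
    have := hU.quiet curr (h2.mem_curr hs) (hs.ne_tail_of_eq h2.val) (.inl (.inr rfl))
    exact ⟨v, h1, h2.step hs hE hU (.inl (.inl rfl)), this.1.trans h3⟩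
  | remUnlockRead prev curr =>
    obtain ⟨h1, h2, h3, h4⟩ := h
    exact ⟨h1, hE.published _ h2, hE.published _ h3, h4⟩
  | remUnlockCas prev curr x =>
    obtain ⟨h1, h2, h3, h4, h5⟩ := h
    exact ⟨h1, hE.published _ h2, hE.published _ h3, h4,
      h5.trans (hU.held curr (.inr rfl)).symm⟩
  | unlockRead prev => exact ⟨h.1, hE.published _ h.2⟩
  | unlockCas prev x =>
    obtain ⟨h1, h2, h3⟩ := h
    exact ⟨h1, hE.published _ h2, h3.trans (hU.held prev rfl).symm⟩

end Stability

/-! ### Steps that change the memory -/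

section Transitions

variable {n : ℕ} {M : Heap n} {K : Set (Ref n)} {a b prev curr : Ref n} {v : ℤ} {p q : Fin n}
  {H : Ref n → Prop}

section Relock

/-- A step that locks or unlocks a node. -/
theorem Evolves.relock (hs : Snap.Sorted ⟨M, K⟩) :
    Evolves ⟨M, K⟩ ⟨Function.update M a { M a with vlock := (M a).vlock + 1 }, K⟩ := by
  have hf : ∀ b, (Function.update M a { M a with vlock := (M a).vlock + 1 } b).val = (M b).val ∧
      (Function.update M a { M a with vlock := (M a).vlock + 1 } b).next = (M b).next ∧
      (Function.update M a { M a with vlock := (M a).vlock + 1 } b).deleted = (M b).deleted ∧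
      (M b).vlock ≤ (Function.update M a { M a with vlock := (M a).vlock + 1 } b).vlock := by
    intro b
    by_cases hb : b = a
    · subst hb; simp
    · simp [hb]
  exact {
    sorted := hs.congr rfl fun b _ => ⟨(hf b).1, (hf b).2.1⟩
    published := fun b => Or.imp id fun h => ((hf b).2.2.1).trans h
    val := fun b _ => (hf b).1
    vlock := fun b => (hf b).2.2.2
    off := fun b _ _ => ⟨(hf b).2.1, (hf b).2.2.1⟩ }

theorem keys_relock (x : ℕ) :
    Snap.keys ⟨Function.update M a { M a with vlock := x }, K⟩ = Snap.keys ⟨M, K⟩ := by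
  ext w
  refine exists_congr fun b => and_congr_right fun _ => ?_
  by_cases hb : b = a
  · subst hb; simp
  · simp [hb]

theorem Undisturbed.relock (x : ℕ) (ha : Snap.Published ⟨M, K⟩ a) (hH : ¬ H a) :
    Undisturbed p H ⟨M, K⟩ ⟨Function.update M a { M a with vlock := x }, K⟩ := by
  refine ⟨fun b hb => ?_, fun b hb _ _ => ?_, fun k hk => ?_⟩
  · have : b ≠ a := by rintro rfl; exact hH hb
    simp [this]
  · refine ⟨?_, hb, ?_⟩
    · by_cases hb : b = a
      · subst hb; simp
      · simp [hb]
    · by_cases hb : (M b).next = a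
      · simp [hb]
      · simp [hb]
  · have : Ref.new p k ≠ a := by rintro rfl; exact hk ha
    simpa [Snap.Published, this] using hk

end Relock

section WritePrivate

variable {N : Node n}

/-- A step that writes a field of a node that has not been linked. -/
theorem Evolves.writePrivate (hs : Snap.Sorted ⟨M, K⟩) (ha : ¬ Snap.Published ⟨M, K⟩ a)
    (hN : N.vlock = (M a).vlock) : Evolves ⟨M, K⟩ ⟨Function.update M a N, K⟩ := by
  have hf : ∀ b, Snap.Published ⟨M, K⟩ b → Function.update M a N b = M b := by
    intro b hb
    have : b ≠ a := by rintro rfl; exact ha hb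
    simp [this]
  exact {
    sorted := hs.congr rfl fun b hb => by simp [hf b (.inl hb)]
    published := fun b hb => by simpa [Snap.Published, hf b hb] using hb
    val := fun b hb => by simp [hf b hb]
    vlock := fun b => by
      by_cases hb : b = a
      · subst hb; simp [hN]
      · simp [hb]
    off := fun b hb _ => by simp [hf b hb] }

theorem keys_writePrivate (ha : ¬ Snap.Published ⟨M, K⟩ a) :
    Snap.keys ⟨Function.update M a N, K⟩ = Snap.keys ⟨M, K⟩ := by
  ext w
  refine exists_congr fun b => and_congr_right fun hb => ?_
  have : b ≠ a := by rintro rfl; exact ha (.inl hb)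
  simp [this]

theorem Undisturbed.writePrivate {k : ℕ} (hs : Snap.Sorted ⟨M, K⟩)
    (ha : ¬ Snap.Published ⟨M, K⟩ (.new q k)) (hpq : p ≠ q)
    (hN : N.vlock = (M (.new q k)).vlock) :
    Undisturbed p H ⟨M, K⟩ ⟨Function.update M (.new q k) N, K⟩ := by
  have hf : ∀ b, Snap.Published ⟨M, K⟩ b → Function.update M (.new q k) N b = M b := by
    intro b hb
    have : b ≠ .new q k := by rintro rfl; exact ha hb
    simp [this]
  refine ⟨fun b hb => ?_, fun b hb hbt _ => ?_, fun k hk => ?_⟩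
  · by_cases hb : b = .new q k
    · subst hb; simp [hN]
    · simp [hb]
  · exact ⟨by simp [hf b (.inl hb)], hb, by simp [hf _ (.inl (hs.next_mem b hb hbt))]⟩
  · simpa [Snap.Published, hpq] using hk

end WritePrivate

section Link

/-- The step of `insert` that links the new node. -/
theorem Evolves.link (hs : Snap.Sorted ⟨M, K⟩) (hp : prev ∈ K) (hpv : (M prev).val < key v)
    (ha : ¬ Snap.Published ⟨M, K⟩ a) (hav : (M a).val = key v) (han : (M a).next = (M prev).next)
    (hv : key v < (M (M prev).next).val) :
    Evolves ⟨M, K⟩ ⟨Function.update M prev { M prev with next := a }, insert a K⟩ := by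
  have haK : a ∉ K := fun h => ha (.inl h)
  have hap : a ≠ prev := by rintro rfl; exact haK hp
  have hpt : prev ≠ .tail := hs.ne_tail_of_lt hpv
  have hval : ∀ b, (Function.update M prev { M prev with next := a } b).val = (M b).val := by
    intro b
    by_cases hb : b = prev
    · subst hb; simp
    · simp [hb]
  have hdel : ∀ b, (Function.update M prev { M prev with next := a } b).deleted =
      (M b).deleted := by
    intro b
    by_cases hb : b = prev
    · subst hb; simp
    · simp [hb]
  have hnext : ∀ b, b ≠ prev →
      (Function.update M prev { M prev with next := a } b).next = (M b).next := by
    intro b hb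
    simp [hb]
  have hnextp : (Function.update M prev { M prev with next := a } prev).next = a := by simp
  -- the values on the chain are at most that of `prev` or greater than `v`
  have hgap : ∀ b ∈ K, (M b).val ≤ (M prev).val ∨ (M (M prev).next).val ≤ (M b).val := by
    intro b hb
    by_contra! h
    exact absurd (hs.next_le prev hp hpt b hb h.1) (not_le.2 h.2)
  exact {
    sorted := {
      head_mem := .inr hs.head_mem
      tail_mem := .inr hs.tail_mem
      val_head := (hval _).trans hs.val_head
      val_tail := (hval _).trans hs.val_tail
      inj := by
        have key_ne : ∀ b ∈ K, (M b).val ≠ (M a).val := by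
          intro b hb hba
          rw [hav] at hba
          rcases hgap b hb with h | h
          · exact absurd (hba ▸ h) (not_le.2 hpv)
          · exact absurd (hba ▸ h) (not_le.2 hv)
        rintro b (rfl | hb) c (rfl | hc) hbc
        · rfl
        · simp only [hval] at hbc; exact absurd hbc.symm (key_ne c hc)
        · simp only [hval] at hbc; exact absurd hbc (key_ne b hb)
        · simp only [hval] at hbc; exact hs.inj b hb c hc hbc
      next_mem := by
        rintro b (rfl | hb) hbt
        · simp only [hnext b hap, han]; exact .inr (hs.next_mem _ hp hpt)
        · by_cases hbp : b = prev
          · subst hbp; simp only [hnextp]; exact .inl rfl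
          · simp only [hnext b hbp]; exact .inr (hs.next_mem b hb hbt)
      lt_next := by
        rintro b (rfl | hb) hbt
        · simp only [hnext b hap, han, hval, hav]; exact hv
        · by_cases hbp : b = prev
          · subst hbp; simp only [hnextp, hval, hav]; exact hpv
          · simp only [hnext b hbp, hval]; exact hs.lt_next b hb hbt
      next_le := by
        rintro b (rfl | hb) hbt c (rfl | hc) hbc
        · exact absurd hbc (lt_irrefl _)
        · simp only [hnext b hap, han, hval, hav] at hbc ⊢
          rcases hgap c hc with h | h
          · exact absurd (hbc.trans_le h) (not_lt.2 hpv.le)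
          · exact h
        · by_cases hbp : b = prev
          · subst hbp; simp only [hnextp, hval]; exact le_rfl
          · simp only [hnext b hbp, hval, hav] at hbc ⊢
            rcases hgap b hb with h | h
            · have hlt : (M b).val < (M prev).val :=
                lt_of_le_of_ne h fun h => hbp (hs.inj b hb prev hp h)
              exact (hs.next_le b hb hbt prev hp hlt).trans hpv.le
            · exact absurd (hv.trans_le h) (not_lt.2 hbc.le)
        · by_cases hbp : b = prev
          · subst hbp
            simp only [hnextp, hval, hav] at hbc ⊢
            exact hv.le.trans (hs.next_le b hb hbt c hc hbc)
          · simp only [hnext b hbp, hval] at hbc ⊢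
            exact hs.next_le b hb hbt c hc hbc }
    published := fun b => Or.imp (fun h => .inr h) fun h => (hdel b).trans h
    val := fun b _ => hval b
    vlock := fun b => by
      by_cases hb : b = prev
      · subst hb; simp
      · simp [hb]
    off := fun b _ hb => by
      have : b ≠ prev := by rintro rfl; exact hb (.inr hp)
      exact ⟨hnext b this, hdel b⟩ }

theorem keys_link (hp : prev ∈ K) (ha : ¬ Snap.Published ⟨M, K⟩ a) (hav : (M a).val = key v) :
    Snap.keys ⟨Function.update M prev { M prev with next := a }, insert a K⟩ =
      Snap.keys ⟨M, K⟩ ∪ {v} := by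
  have hap : a ≠ prev := by rintro rfl; exact ha (.inl hp)
  have had : (M a).deleted = false := by
    by_contra h
    exact ha (.inr (by simpa using h))
  have hf : ∀ b w, ((Function.update M prev { M prev with next := a } b).val = key w ∧
      (Function.update M prev { M prev with next := a } b).deleted = false) ↔
      ((M b).val = key w ∧ (M b).deleted = false) := by
    intro b w
    by_cases hb : b = prev
    · subst hb; simp
    · simp [hb]
  ext w
  simp only [Snap.keys, Set.mem_ofPred_eq, hf, Set.mem_union, Set.mem_singleton_iff]
  constructor
  · rintro ⟨b, rfl | hb, h⟩
    · exact .inr (key_inj.1 (h.1.symm.trans hav))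
    · exact .inl ⟨b, hb, h⟩
  · rintro (⟨b, hb, h⟩ | rfl)
    · exact ⟨b, .inr hb, h⟩
    · exact ⟨a, .inl rfl, hav, had⟩

theorem Undisturbed.link {k : ℕ} (hp : prev ∈ K) (hodd : Odd (M prev).vlock) (hH : ¬ H prev)
    (hpq : p ≠ q) : Undisturbed p H ⟨M, K⟩
      ⟨Function.update M prev { M prev with next := .new q k }, insert (.new q k) K⟩ := by
  refine ⟨fun b hb => ?_, fun b hb hbt hbl => ?_, fun k hk => ?_⟩
  · have : b ≠ prev := by rintro rfl; exact hH hb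
    simp [this]
  · have hbp : b ≠ prev := by
      rintro rfl
      exact hbl.elim hH fun h => Nat.not_even_iff_odd.2 hodd h.1
    refine ⟨by simp [hbp], .inr hb, ?_⟩
    by_cases hc : (M b).next = prev
    · simp [hc]
    · simp [hc]
  · have : Ref.new p k ≠ prev := by rintro rfl; exact hk (.inl hp)
    simpa [Snap.Published, this, hpq] using hk

end Link

section Mark

/-- The step of `remove` that marks the node. -/
theorem Evolves.mark (hs : Snap.Sorted ⟨M, K⟩) (ha : a ∈ K) :
    Evolves ⟨M, K⟩ ⟨Function.update M a { M a with deleted := true }, K⟩ := by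
  have hf : ∀ b, (Function.update M a { M a with deleted := true } b).val = (M b).val ∧
      (Function.update M a { M a with deleted := true } b).next = (M b).next ∧
      (Function.update M a { M a with deleted := true } b).vlock = (M b).vlock := by
    intro b
    by_cases hb : b = a
    · subst hb; simp
    · simp [hb]
  have hd : ∀ b, (M b).deleted = true →
      (Function.update M a { M a with deleted := true } b).deleted = true := by
    intro b h
    by_cases hb : b = a
    · subst hb; simp
    · simpa [hb] using h
  exact {
    sorted := hs.congr rfl fun b _ => ⟨(hf b).1, (hf b).2.1⟩
    published := fun b => Or.imp id (hd b)
    val := fun b _ => (hf b).1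
    vlock := fun b => (hf b).2.2.ge
    off := fun b _ hb => by
      have : b ≠ a := by rintro rfl; exact hb ha
      simp [this] }

theorem keys_mark (hs : Snap.Sorted ⟨M, K⟩) (ha : a ∈ K) (hav : (M a).val = key v) :
    Snap.keys ⟨Function.update M a { M a with deleted := true }, K⟩ =
      Snap.keys ⟨M, K⟩ \ {v} := by
  ext w
  simp only [Snap.keys, Set.mem_ofPred_eq, Set.mem_sdiff, Set.mem_singleton_iff]
  constructor
  · rintro ⟨b, hb, h⟩
    have hba : b ≠ a := by rintro rfl; simp at h
    simp only [Function.update_of_ne hba] at h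
    refine ⟨⟨b, hb, h⟩, ?_⟩
    rintro rfl
    exact hba (hs.inj b hb a ha (h.1.trans hav.symm))
  · rintro ⟨⟨b, hb, h⟩, hwv⟩
    have hba : b ≠ a := by
      rintro rfl
      exact hwv (key_inj.1 (h.1.symm.trans hav))
    exact ⟨b, hb, by simpa only [Function.update_of_ne hba] using h⟩

theorem Undisturbed.mark (hs : Snap.Sorted ⟨M, K⟩) (hR : Removing ⟨M, K⟩ v prev curr false)
    (hodd : Odd (M prev).vlock) (hH : ¬ H prev) :
    Undisturbed p H ⟨M, K⟩ ⟨Function.update M curr { M curr with deleted := true }, K⟩ := by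
  have hc := hR.mem_curr hs
  refine ⟨fun b hb => ?_, fun b hb hbt hbl => ⟨?_, hb, ?_⟩, fun k hk => ?_⟩
  · by_cases hb : b = curr
    · subst hb; simp
    · simp [hb]
  · by_cases hb : b = curr
    · subst hb; simp
    · simp [hb]
  · -- the only predecessor of the marked node is locked
    have : (M b).next ≠ curr := by
      intro h
      obtain rfl := hs.next_inj hb hR.mem hbt (hs.ne_tail_of_lt hR.lt) (h.trans hR.next.symm)
      exact hbl.elim hH fun h => Nat.not_even_iff_odd.2 hodd h.1
    simp [this]
  · have : Ref.new p k ≠ curr := by rintro rfl; exact hk (.inl hc)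
    simpa [Snap.Published, this] using hk

end Mark

section Unlink

/-- The step of `remove` that unlinks the node. -/
theorem Evolves.unlink (hs : Snap.Sorted ⟨M, K⟩) (hR : Removing ⟨M, K⟩ v prev curr true) :
    Evolves ⟨M, K⟩
      ⟨Function.update M prev { M prev with next := (M curr).next }, K \ {curr}⟩ := by
  obtain ⟨hp, hn, hpv, hcv, hcd⟩ := id hR
  simp only at hp hn hpv hcv hcd
  have hc : curr ∈ K := hR.mem_curr hs
  have hpt : prev ≠ .tail := hs.ne_tail_of_lt hpv
  have hct : curr ≠ .tail := hs.ne_tail_of_eq hcv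
  have hch : curr ≠ .head := hs.ne_head_of_eq hcv
  have hval : ∀ b, (Function.update M prev { M prev with next := (M curr).next } b).val =
      (M b).val := by
    intro b
    by_cases hb : b = prev
    · subst hb; simp
    · simp [hb]
  have hdel : ∀ b, (Function.update M prev { M prev with next := (M curr).next } b).deleted =
      (M b).deleted := by
    intro b
    by_cases hb : b = prev
    · subst hb; simp
    · simp [hb]
  have hnext : ∀ b, b ≠ prev →
      (Function.update M prev { M prev with next := (M curr).next } b).next = (M b).next := by
    intro b hb
    simp [hb]
  have hnextp : (Function.update M prev { M prev with next := (M curr).next } prev).next =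
      (M curr).next := by simp
  have hlt : (M prev).val < (M curr).val := by rw [hcv]; exact hpv
  have hltn : (M curr).val < (M (M curr).next).val := hs.lt_next curr hc hct
  exact {
    sorted := {
      head_mem := ⟨hs.head_mem, fun h => hch (Eq.symm h)⟩
      tail_mem := ⟨hs.tail_mem, fun h => hct (Eq.symm h)⟩
      val_head := (hval _).trans hs.val_head
      val_tail := (hval _).trans hs.val_tail
      inj := by
        intro b hb c hc hbc
        simp only [hval] at hbc
        exact hs.inj b hb.1 c hc.1 hbc
      next_mem := by
        intro b hb hbt
        by_cases hbp : b = prev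
        · subst hbp
          simp only [hnextp]
          refine ⟨hs.next_mem curr hc hct, fun h => ?_⟩
          rw [Set.mem_singleton_iff.1 h] at hltn
          exact lt_irrefl _ hltn
        · simp only [hnext b hbp]
          refine ⟨hs.next_mem b hb.1 hbt, fun h => hbp ?_⟩
          exact hs.next_inj hb.1 hp hbt hpt ((Set.mem_singleton_iff.1 h).trans hn.symm)
      lt_next := by
        intro b hb hbt
        by_cases hbp : b = prev
        · subst hbp; simp only [hnextp, hval]; exact hlt.trans hltn
        · simp only [hnext b hbp, hval]; exact hs.lt_next b hb.1 hbt
      next_le := by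
        intro b hb hbt c hc' hbc
        simp only [hval] at hbc
        by_cases hbp : b = prev
        · subst hbp
          simp only [hnextp, hval]
          refine hs.next_le curr hc hct c hc'.1 (lt_of_le_of_ne ?_ fun h => hc'.2 ?_)
          · have := hs.next_le b hp hpt c hc'.1 hbc
            simpa only [hn] using this
          · exact (hs.inj curr hc c hc'.1 h).symm
        · simp only [hnext b hbp, hval]
          exact hs.next_le b hb.1 hbt c hc'.1 hbc }
    published := by
      rintro b (hb | hb)
      · by_cases hbc : b = curr
        · subst hbc; exact .inr ((hdel b).trans hcd)
        · exact .inl ⟨hb, hbc⟩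
      · exact .inr ((hdel b).trans hb)
    val := fun b _ => hval b
    vlock := fun b => by
      by_cases hb : b = prev
      · subst hb; simp
      · simp [hb]
    off := fun b _ hb => by
      have : b ≠ prev := by
        rintro rfl
        exact hb ⟨hp, hR.ne⟩
      exact ⟨hnext b this, hdel b⟩ }

theorem keys_unlink (hd : (M curr).deleted = true) :
    Snap.keys ⟨Function.update M prev { M prev with next := b }, K \ {curr}⟩ =
      Snap.keys ⟨M, K⟩ := by
  have hf : ∀ c w, ((Function.update M prev { M prev with next := b } c).val = key w ∧
      (Function.update M prev { M prev with next := b } c).deleted = false) ↔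
      ((M c).val = key w ∧ (M c).deleted = false) := by
    intro c w
    by_cases hc : c = prev
    · subst hc; simp
    · simp [hc]
  ext w
  simp only [Snap.keys, Set.mem_ofPred_eq, hf]
  constructor
  · rintro ⟨c, hc, h⟩
    exact ⟨c, hc.1, h⟩
  · rintro ⟨c, hc, h⟩
    refine ⟨c, ⟨hc, ?_⟩, h⟩
    rintro rfl
    rw [hd] at h
    exact absurd h.2 (by simp)

theorem Undisturbed.unlink (hR : Removing ⟨M, K⟩ v prev curr true)
    (hodd : Odd (M prev).vlock) (hodd' : Odd (M curr).vlock) (hH : ¬ H prev) (hH' : ¬ H curr) :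
    Undisturbed p H ⟨M, K⟩
      ⟨Function.update M prev { M prev with next := b }, K \ {curr}⟩ := by
  refine ⟨fun b hb => ?_, fun b hb hbt hbl => ?_, fun k hk => ?_⟩
  · have : b ≠ prev := by rintro rfl; exact hH hb
    simp [this]
  · have hbp : b ≠ prev := by
      rintro rfl
      exact hbl.elim hH fun h => Nat.not_even_iff_odd.2 hodd h.1
    have hbc : b ≠ curr := by
      rintro rfl
      exact hbl.elim hH' fun h => Nat.not_even_iff_odd.2 hodd' h.1
    refine ⟨by simp [hbp], ⟨hb, hbc⟩, ?_⟩
    by_cases hc : (M b).next = prev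
    · simp [hc]
    · simp [hc]
  · have : Ref.new p k ≠ prev := by rintro rfl; exact hk (.inl hR.mem)
    have h : Ref.new p k ∉ K ∧ (M (Ref.new p k)).deleted = false := by
      simpa [Snap.Published] using hk
    simp [Snap.Published, this, h.1, h.2]

end Unlink

end Transitions

/-! ### The simulation -/

section Simulation

variable {n : ℕ}

/-- The invariant of the algorithm. `K` is the set of the nodes on the chain, `S p` contains the
snapshots since the last invocation by `p`, and `st p` is the status of `p`. -/
structure Inv (C : Config n) (K : Set (Ref n)) (S : Fin n → Set (Snap n))
    (st : Fin n → Status SetOp Bool) : Prop where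
  sorted : Snap.Sorted ⟨C.mem, K⟩
  hindsight : ∀ p, Hindsight (S p) ⟨C.mem, K⟩
  fresh : ∀ p k, (C.loc p).allocs ≤ k → ¬ Snap.Published ⟨C.mem, K⟩ (.new p k)
  odd : ∀ p a, Holds (C.loc p).pc a → Odd (C.mem a).vlock
  excl : ∀ p q a, Holds (C.loc p).pc a → Holds (C.loc q).pc a → p = q
  pc : ∀ p, PCInv ⟨C.mem, K⟩ (S p) p (C.loc p) (st p)

/-- The history `H` has a partial linearization in agreement with the configuration `C`. -/
def Sim (H : List (HEvent (Fin n) SetOp Bool)) (C : Config n) : Prop :=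
  ∃ K S st, LinTrace (τ := setType) H (Snap.keys ⟨C.mem, K⟩) st (fun p => Snap.keys '' S p) ∧
    Inv C K S st

theorem setType_det (q : setType.State) (op : setType.Op) (q1 q2 : setType.State)
    (r : setType.Resp) (h1 : setType.trans q op q1 r) (h2 : setType.trans q op q2 r) :
    q1 = q2 := by
  cases op <;> exact h1.1.trans h2.1.symm

variable {C : Config n} {K : Set (Ref n)} {S : Fin n → Set (Snap n)}
  {st : Fin n → Status SetOp Bool} {H : List (HEvent (Fin n) SetOp Bool)} {p : Fin n}
  {pc pc' : PC n} {al al' : ℕ}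

/-- The invariant is preserved by a step of process `p` from local state `⟨pc, al⟩` to
`⟨pc', al'⟩` with a new snapshot `t`. -/
theorem Inv.step (hI : Inv C K S st) (hloc : C.loc p = ⟨pc, al⟩) (t : Snap n)
    (st' : Status SetOp Bool) (hE : Evolves ⟨C.mem, K⟩ t)
    (hU : ∀ q, q ≠ p → Undisturbed q (Holds (C.loc q).pc) ⟨C.mem, K⟩ t)
    (hfresh : ∀ k, al' ≤ k → ¬ t.Published (.new p k))
    (hodd : ∀ a, Holds pc' a → Odd (t.mem a).vlock)
    (hexcl : ∀ a, Holds pc' a → Holds pc a ∨ ∀ q, q ≠ p → ¬ Holds (C.loc q).pc a)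
    (hpc : PCInv t (insert t (S p)) p ⟨pc', al'⟩ st') :
    Inv { mem := t.mem, loc := Function.update C.loc p ⟨pc', al'⟩ } t.nodes
      (fun q => insert t (S q)) (Function.update st p st') where
  sorted := hE.sorted
  hindsight q := (hI.hindsight q).insert hE
  fresh q k hk := by
    by_cases hq : q = p
    · subst hq
      exact hfresh k (by simpa using hk)
    · simp only [Function.update_of_ne hq] at hk
      exact ((hU q hq).own k (hI.fresh q k hk)).2
  odd q a ha := by
    by_cases hq : q = p
    · subst hq
      exact hodd a (by simpa using ha)
    · simp only [Function.update_of_ne hq] at ha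
      have := hI.odd q a ha
      rwa [← (hU q hq).held a ha] at this
  excl := by
    have key : ∀ q a, q ≠ p → Holds pc' a → ¬ Holds (C.loc q).pc a := by
      intro q a hq ha ha'
      rcases hexcl a ha with h | h
      · exact hq (hI.excl q p a ha' (by rwa [hloc]))
      · exact h q hq ha'
    intro q r a hq hr
    by_cases hqp : q = p <;> by_cases hrp : r = p
    · exact hqp.trans hrp.symm
    · subst hqp
      simp only [Function.update_self, Function.update_of_ne hrp] at hq hr
      exact absurd hr (key r a hrp hq)
    · subst hrp
      simp only [Function.update_self, Function.update_of_ne hqp] at hq hr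
      exact absurd hq (key q a hqp hr)
    · simp only [Function.update_of_ne hqp, Function.update_of_ne hrp] at hq hr
      exact hI.excl q r a hq hr
  pc q := by
    by_cases hq : q = p
    · subst hq
      simpa only [Function.update_self] using hpc
    · simp only [Function.update_of_ne hq]
      exact (hI.pc q).stable (hI.hindsight q) hE (hU q hq)

/-- A step that does not change the memory. -/
theorem Inv.local (hI : Inv C K S st) (hloc : C.loc p = ⟨pc, al⟩) (st' : Status SetOp Bool)
    (hh : ∀ a, Holds pc' a → Holds pc a)
    (hpc : PCInv ⟨C.mem, K⟩ (S p) p ⟨pc', al⟩ st') :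
    Inv { mem := C.mem, loc := Function.update C.loc p ⟨pc', al⟩ } K S
      (Function.update st p st') := by
  have hS : ∀ q, insert ⟨C.mem, K⟩ (S q) = S q := fun q =>
    Set.insert_eq_of_mem (hI.hindsight q).now
  have := hI.step hloc (pc' := pc') (al' := al) ⟨C.mem, K⟩ st' (.refl hI.sorted)
    (fun q _ => .refl q _ _) (fun k hk => hI.fresh p k (by rwa [hloc]))
    (fun a ha => hI.odd p a (by rw [hloc]; exact hh a ha)) (fun a ha => .inl (hh a ha))
    (by rwa [hS])
  simpa only [hS] using this

theorem Sim.goto (hL : LinTrace (τ := setType) H (Snap.keys ⟨C.mem, K⟩) st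
      (fun p => Snap.keys '' S p))
    (hI : Inv C K S st) (hloc : C.loc p = ⟨pc, al⟩)
    (hpc : PCInv ⟨C.mem, K⟩ (S p) p ⟨pc', al⟩ (st p))
    (hh : ∀ a, Holds pc' a → Holds pc a := by exact fun _ h => h) :
    Sim H { mem := C.mem, loc := Function.update C.loc p ⟨pc', al⟩ } := by
  refine ⟨K, S, st, hL, ?_⟩
  have := hI.local hloc (st p) hh hpc
  rwa [Function.update_eq_self] at this

/-- The operation is linearized retroactively in a snapshot `u` and is about to return. -/
theorem Sim.ret (hL : LinTrace (τ := setType) H (Snap.keys ⟨C.mem, K⟩) st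
      (fun p => Snap.keys '' S p))
    (hI : Inv C K S st) (hloc : C.loc p = ⟨pc, al⟩) {op : SetOp} {r : Bool}
    (hst : st p = .pend op) {u : Snap n} (hu : u ∈ S p)
    (ht : setType.trans u.keys op u.keys r) :
    Sim H { mem := C.mem, loc := Function.update C.loc p ⟨.ret r, al⟩ } :=
  ⟨K, S, _, hL.lin_past setType_det hst ⟨u, hu, rfl⟩ ht,
    hI.local hloc (.done r) (fun _ h => h.elim) rfl⟩

/-- A step that changes the memory but not the abstract set. -/
theorem Sim.silent (hL : LinTrace (τ := setType) H (Snap.keys ⟨C.mem, K⟩) st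
      (fun p => Snap.keys '' S p))
    (hI : Inv C K S st) (hloc : C.loc p = ⟨pc, al⟩) {t : Snap n}
    (hkeys : t.keys = Snap.keys ⟨C.mem, K⟩) (hE : Evolves ⟨C.mem, K⟩ t)
    (hU : ∀ q, q ≠ p → Undisturbed q (Holds (C.loc q).pc) ⟨C.mem, K⟩ t)
    (hfresh : ∀ k, al' ≤ k → ¬ t.Published (.new p k))
    (hodd : ∀ a, Holds pc' a → Odd (t.mem a).vlock)
    (hexcl : ∀ a, Holds pc' a → Holds pc a ∨ ∀ q, q ≠ p → ¬ Holds (C.loc q).pc a)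
    (hpc : PCInv t (insert t (S p)) p ⟨pc', al'⟩ (st p)) :
    Sim H { mem := t.mem, loc := Function.update C.loc p ⟨pc', al'⟩ } := by
  refine ⟨t.nodes, fun q => insert t (S q), st, ?_, ?_⟩
  · have : (⟨t.mem, t.nodes⟩ : Snap n).keys = Snap.keys ⟨C.mem, K⟩ := hkeys
    rw [this]
    refine hL.mono fun q => ?_
    rintro _ ⟨u, rfl | hu, rfl⟩
    · exact ⟨_, (hI.hindsight q).now, hkeys.symm⟩
    · exact ⟨u, hu, rfl⟩
  · have := hI.step hloc t (st p) hE hU hfresh hodd hexcl hpc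
    rwa [Function.update_eq_self] at this

/-- A step at which a pending operation takes effect. -/
theorem Sim.effect (hL : LinTrace (τ := setType) H (Snap.keys ⟨C.mem, K⟩) st
      (fun p => Snap.keys '' S p))
    (hI : Inv C K S st) (hloc : C.loc p = ⟨pc, al⟩) {op : SetOp} {r : Bool}
    (hst : st p = .pend op) {t : Snap n}
    (ht : setType.trans (Snap.keys ⟨C.mem, K⟩) op t.keys r) (hE : Evolves ⟨C.mem, K⟩ t)
    (hU : ∀ q, q ≠ p → Undisturbed q (Holds (C.loc q).pc) ⟨C.mem, K⟩ t)
    (hfresh : ∀ k, al' ≤ k → ¬ t.Published (.new p k))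
    (hodd : ∀ a, Holds pc' a → Odd (t.mem a).vlock)
    (hexcl : ∀ a, Holds pc' a → Holds pc a ∨ ∀ q, q ≠ p → ¬ Holds (C.loc q).pc a)
    (hpc : PCInv t (insert t (S p)) p ⟨pc', al'⟩ (.done r)) :
    Sim H { mem := t.mem, loc := Function.update C.loc p ⟨pc', al'⟩ } := by
  refine ⟨t.nodes, fun q => insert t (S q), _, (hL.lin hst ht).mono fun q => ?_,
    hI.step hloc t _ hE hU hfresh hodd hexcl hpc⟩
  rintro _ ⟨u, rfl | hu, rfl⟩
  · exact .inl rfl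
  · exact .inr ⟨u, hu, rfl⟩

theorem trans_of_present {s : Set ℤ} {v : ℤ} (h : v ∈ s) :
    setType.trans s (.contains v) s true ∧ setType.trans s (.insert v) s false := by
  simp [setType, h]

theorem trans_of_absent {s : Set ℤ} {v : ℤ} (h : v ∉ s) :
    setType.trans s (.contains v) s false ∧ setType.trans s (.remove v) s false := by
  simp [setType, h]

theorem even_version (x : ℕ) : Even (version x) := ⟨x / 2, by unfold version; omega⟩

theorem version_le (x : ℕ) : version x ≤ x := by unfold version; omega

/-- If the lock is held when its version is read, then the version obtained is already outdated, so
that a CAS from it will fail. -/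
theorem versionRead {s : Snap n} (a : Ref n) : VersionRead s a (version (s.mem a).vlock) :=
  ⟨even_version _, version_le _⟩

/-- A process that holds a lock excludes all others. -/
theorem Inv.not_holds (hI : Inv C K S st) (hloc : C.loc p = ⟨pc, al⟩) {a : Ref n}
    (ha : Holds pc a) (q : Fin n) (hq : q ≠ p) : ¬ Holds (C.loc q).pc a :=
  fun h => hq (hI.excl q p a h (by rwa [hloc]))

/-- Nobody holds a lock whose value is even. -/
theorem Inv.not_holds_of_even (hI : Inv C K S st) {a : Ref n} (ha : Even (C.mem a).vlock)
    (q : Fin n) : ¬ Holds (C.loc q).pc a :=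
  fun h => Nat.not_even_iff_odd.2 (hI.odd q a h) ha

theorem Inv.odd_of_holds (hI : Inv C K S st) (hloc : C.loc p = ⟨pc, al⟩) {a : Ref n}
    (ha : Holds pc a) : Odd (C.mem a).vlock := hI.odd p a (by rwa [hloc])

/-- A successful CAS on a lock, by the holder of the lock or on an unlocked lock. -/
theorem Sim.relock (hL : LinTrace (τ := setType) H (Snap.keys ⟨C.mem, K⟩) st
      (fun p => Snap.keys '' S p))
    (hI : Inv C K S st) (hloc : C.loc p = ⟨pc, al⟩) {a : Ref n} {x : ℕ}
    (hx : (C.mem a).vlock = x) (ha : Snap.Published ⟨C.mem, K⟩ a)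
    (hfree : ∀ q, q ≠ p → ¬ Holds (C.loc q).pc a)
    (hh : ∀ b, Holds pc' b → b ≠ a ∧ Holds pc b ∨ b = a ∧ Even x)
    (hpc : Evolves ⟨C.mem, K⟩ ⟨Function.update C.mem a { C.mem a with vlock := x + 1 }, K⟩ →
      PCInv ⟨Function.update C.mem a { C.mem a with vlock := x + 1 }, K⟩
        (insert ⟨Function.update C.mem a { C.mem a with vlock := x + 1 }, K⟩ (S p)) p
        ⟨pc', al⟩ (st p)) :
    Sim H { mem := Function.update C.mem a { C.mem a with vlock := x + 1 },
            loc := Function.update C.loc p ⟨pc', al⟩ } := by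
  subst hx
  have hE : Evolves ⟨C.mem, K⟩ _ := .relock (a := a) hI.sorted
  refine Sim.silent hL hI hloc
    (t := ⟨Function.update C.mem a { C.mem a with vlock := (C.mem a).vlock + 1 }, K⟩)
    (keys_relock _) hE
    (fun q hq => .relock _ ha (hfree q hq)) (fun k hk => ?_) (fun b hb => ?_) (fun b hb => ?_)
    (hpc hE)
  · have h := hI.fresh p k (by rwa [hloc])
    have : Ref.new p k ≠ a := by rintro rfl; exact h ha
    simpa [Snap.Published, this] using h
  · rcases hh b hb with ⟨h1, h2⟩ | ⟨rfl, h2⟩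
    · simpa [h1] using hI.odd_of_holds hloc h2
    · simpa using h2.add_one
  · rcases hh b hb with ⟨-, h2⟩ | ⟨rfl, -⟩
    · exact .inl h2
    · exact .inr hfree

/-- Every primitive preserves the simulation. -/
theorem Sim.prim (h : Sim H C) {M : Heap n} {l : Local n}
    (hrun : (action p (C.loc p)).run C.mem = some (M, l)) :
    Sim H { mem := M, loc := Function.update C.loc p l } := by
  obtain ⟨K, S, st, hL, hI⟩ := h
  have hs := hI.sorted
  have hS := hI.hindsight p
  have hp := hI.pc p
  rcases hloc : C.loc p with ⟨pc, al⟩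
  rw [hloc] at hrun hp
  cases pc with
  | idle => simp [action, Action.run] at hrun
  | ret b => simp [action, Action.run] at hrun
  | containsTest v curr =>
    simp only [action, Action.run, Option.some.injEq, Prod.mk.injEq] at hrun
    obtain ⟨rfl, rfl⟩ := hrun
    obtain ⟨h1, h2⟩ := hp
    split
    next hlt => exact .goto hL hI hloc ⟨h1, h2.1, hlt⟩
    next hlt => exact .goto hL hI hloc ⟨h1, h2, not_lt.1 hlt⟩
  | containsNext v curr =>
    simp only [action, Action.run, Option.some.injEq, Prod.mk.injEq] at hrun
    obtain ⟨rfl, rfl⟩ := hrun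
    obtain ⟨h1, h2⟩ := hp
    exact .goto hL hI hloc ⟨h1, hS.seen_next h2.1 h2.2⟩
  | containsVal v curr =>
    simp only [action, Action.run, Option.some.injEq, Prod.mk.injEq] at hrun
    obtain ⟨rfl, rfl⟩ := hrun
    obtain ⟨h1, h2, h3⟩ := hp
    split
    next heq => exact .goto hL hI hloc ⟨h1, h2.1, heq⟩
    next hne =>
      obtain ⟨u, hu, hv⟩ := h2.2 (lt_of_le_of_ne h3 (Ne.symm hne))
      exact .ret hL hI hloc h1 hu (trans_of_absent hv).1
  | containsDel v curr =>
    simp only [action, Action.run, Option.some.injEq, Prod.mk.injEq] at hrun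
    obtain ⟨rfl, rfl⟩ := hrun
    obtain ⟨h1, h2, h3⟩ := hp
    cases hd : (C.mem curr).deleted with
    | true =>
      obtain ⟨u, hu, hv⟩ := hS.absent_of_deleted h2 h3 hd
      exact .ret hL hI hloc h1 hu (trans_of_absent hv).1
    | false =>
      obtain ⟨u, hu, hv⟩ := hS.present_of_not_deleted h2 h3 hd
      exact .ret hL hI hloc h1 hu (trans_of_present hv).1
  | travTest u v prev curr =>
    simp only [action, Action.run, Option.some.injEq, Prod.mk.injEq] at hrun
    obtain ⟨rfl, rfl⟩ := hrun
    obtain ⟨h1, h2, h3⟩ := hp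
    split
    next hlt => exact .goto hL hI hloc ⟨h1, h3.1, hlt⟩
    next hlt => exact .goto hL hI hloc ⟨h1, h2⟩
  | travNext u v curr =>
    simp only [action, Action.run, Option.some.injEq, Prod.mk.injEq] at hrun
    obtain ⟨rfl, rfl⟩ := hrun
    obtain ⟨h1, h2⟩ := hp
    exact .goto hL hI hloc ⟨h1, h2, hS.seen_next h2.1 h2.2⟩
  | valStart u v prev =>
    simp only [action, Action.run, Option.some.injEq, Prod.mk.injEq] at hrun
    obtain ⟨rfl, rfl⟩ := hrun
    obtain ⟨h1, h2⟩ := hp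
    exact .goto hL hI hloc ⟨h1, h2, versionRead (s := ⟨C.mem, K⟩) prev⟩
  | valPrevDel u v prev pVer =>
    simp only [action, Action.run, Option.some.injEq, Prod.mk.injEq] at hrun
    obtain ⟨rfl, rfl⟩ := hrun
    obtain ⟨h1, h2, h3⟩ := hp
    split
    next hd =>
      have hh : Seen (S p) .head := hS.seen_of_mem hs.head_mem
      have hv : (C.mem .head).val < key v := by rw [hs.val_head]; exact bot_lt_key v
      exact .goto hL hI hloc ⟨h1, ⟨hh, hv⟩, hh, fun h => absurd h (not_lt.2 hv.le)⟩
    next hd =>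
      exact .goto hL hI hloc ⟨h1, h2, h3, fun _ =>
        ⟨hS.mem_of_seen h2.1 (by simpa using hd), rfl⟩⟩
  | valNext u v prev pVer =>
    simp only [action, Action.run, Option.some.injEq, Prod.mk.injEq] at hrun
    obtain ⟨rfl, rfl⟩ := hrun
    obtain ⟨h1, h2, h3, h4⟩ := hp
    exact .goto hL hI hloc ⟨h1, h2, h3, h4, hS.seen_next h2.1 h2.2⟩
  | valTest u v prev pVer curr =>
    simp only [action, Action.run, Option.some.injEq, Prod.mk.injEq] at hrun
    obtain ⟨rfl, rfl⟩ := hrun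
    obtain ⟨h1, h2, h3, h4, h5⟩ := hp
    split
    next hlt => exact .goto hL hI hloc ⟨h1, h2, h5.1, hlt⟩
    next hlt =>
      cases u with
      | ins => exact .goto hL hI hloc ⟨h1, h2, h3, h4, h5.1, not_lt.1 hlt⟩
      | rem => exact .goto hL hI hloc ⟨h1, h2, h3, h4, h5, not_lt.1 hlt⟩
  | valCurrVer u v prev curr =>
    simp only [action, Action.run, Option.some.injEq, Prod.mk.injEq] at hrun
    obtain ⟨rfl, rfl⟩ := hrun
    obtain ⟨h1, h2, h3⟩ := hp
    exact .goto hL hI hloc ⟨h1, h2, h3, versionRead (s := ⟨C.mem, K⟩) curr⟩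
  | valCurrDel u v prev pVer curr =>
    simp only [action, Action.run, Option.some.injEq, Prod.mk.injEq] at hrun
    obtain ⟨rfl, rfl⟩ := hrun
    obtain ⟨h1, h2, h3, h4⟩ := hp
    split
    next hd => exact .goto hL hI hloc ⟨h1, h2⟩
    next hd =>
      exact .goto hL hI hloc ⟨h1, h3, h4, fun _ =>
        ⟨hS.mem_of_seen h3.1 (by simpa using hd), rfl⟩⟩
  | insDel v prev pVer curr =>
    simp only [action, Action.run, Option.some.injEq, Prod.mk.injEq] at hrun
    obtain ⟨rfl, rfl⟩ := hrun
    obtain ⟨h1, h2, h3, h4, h5, h6⟩ := hp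
    split
    next hd => exact .goto hL hI hloc ⟨h1, h2⟩
    next hd =>
      exact .goto hL hI hloc ⟨h1, h2, h3, h4, h5, h6, fun hv =>
        hS.present_of_not_deleted h5 hv (by simpa using hd)⟩
  | insVal v prev pVer curr =>
    simp only [action, Action.run, Option.some.injEq, Prod.mk.injEq] at hrun
    obtain ⟨rfl, rfl⟩ := hrun
    obtain ⟨h1, h2, h3, h4, h5, h6, h7⟩ := hp
    split
    next heq =>
      obtain ⟨u, hu, hv⟩ := h7 heq
      exact .ret hL hI hloc h1 hu (trans_of_present hv).2
    next hne =>
      exact .goto hL hI hloc ⟨h1, h2, h3, h4, h5, lt_of_le_of_ne h6 (Ne.symm hne)⟩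
  | insNewVal v prev pVer curr =>
    simp only [action, Action.run, Option.some.injEq, Prod.mk.injEq] at hrun
    obtain ⟨rfl, rfl⟩ := hrun
    have ha : ¬ Snap.Published ⟨C.mem, K⟩ (.new p al) := hI.fresh p al (by rw [hloc])
    have hE : Evolves ⟨C.mem, K⟩
        ⟨Function.update C.mem (.new p al) { C.mem (.new p al) with val := key v }, K⟩ :=
      .writePrivate hs ha rfl
    have hne : ∀ b, Seen (S p) b → b ≠ .new p al := by
      rintro b hb rfl
      exact ha (hS.published_of_seen hb)
    obtain ⟨h1, h2, h3, h4, h5, h6⟩ := hp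
    have hpub : ∀ k, ¬ Snap.Published ⟨C.mem, K⟩ (.new p k) → ¬ Snap.Published
        ⟨Function.update C.mem (.new p al) { C.mem (.new p al) with val := key v }, K⟩
        (.new p k) := by
      intro k hk
      by_cases hkal : k = al
      · subst hkal; simpa [Snap.Published] using hk
      · simpa [Snap.Published, hkal] using hk
    refine .silent hL hI hloc
      (t := ⟨Function.update C.mem (.new p al) { C.mem (.new p al) with val := key v }, K⟩)
      (keys_writePrivate ha) hE
      (fun q hq => .writePrivate hs ha hq rfl)
      (fun k hk => hpub k (hI.fresh p k (by rw [hloc]; exact (Nat.le_succ al).trans hk)))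
      (fun _ h => h.elim) (fun _ h => h.elim)
      ⟨h1, h2.step hS hE, h3.step hE, ?_, h5.insert, by rwa [hS.val_eq hE h5],
        ⟨al, Nat.lt_succ_self al, rfl⟩, hpub al ha, by simp⟩
    intro hv
    simp only [Function.update_of_ne (hne prev h2.1)] at hv ⊢
    exact h4 hv
  | insNewNext v prev pVer curr newNode =>
    simp only [action, Action.run, Option.some.injEq, Prod.mk.injEq] at hrun
    obtain ⟨rfl, rfl⟩ := hrun
    obtain ⟨h1, h2, h3, h4, h5, h6, ⟨k, hk, rfl⟩, ha, h8⟩ := hp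
    have hE : Evolves ⟨C.mem, K⟩
        ⟨Function.update C.mem (.new p k) { C.mem (.new p k) with next := curr }, K⟩ :=
      .writePrivate hs ha rfl
    have hne : ∀ b, Seen (S p) b → b ≠ .new p k := by
      rintro b hb rfl
      exact ha (hS.published_of_seen hb)
    have hpub : ∀ k', ¬ Snap.Published ⟨C.mem, K⟩ (.new p k') → ¬ Snap.Published
        ⟨Function.update C.mem (.new p k) { C.mem (.new p k) with next := curr }, K⟩
        (.new p k') := by
      intro k' hk'
      by_cases hkk : k' = k
      · subst hkk; simpa [Snap.Published] using hk'
      · simpa [Snap.Published, hkk] using hk'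
    refine .silent hL hI hloc
      (t := ⟨Function.update C.mem (.new p k) { C.mem (.new p k) with next := curr }, K⟩)
      (keys_writePrivate ha) hE
      (fun q hq => .writePrivate hs ha hq rfl)
      (fun k hk => hpub k (hI.fresh p k (by rwa [hloc])))
      (fun _ h => h.elim) (fun _ h => h.elim)
      ⟨curr, h1, h2.step hS hE, h3.step hE, ?_, h5.insert, by rwa [hS.val_eq hE h5],
        ⟨⟨k, hk, rfl⟩, hpub k ha, by simpa using h8⟩, by simp⟩
    intro hv
    simp only [Function.update_of_ne (hne prev h2.1)] at hv ⊢
    exact h4 hv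
  | insLock v prev pVer newNode =>
    obtain ⟨curr, h1, h2, h3, h4, h5, h6, ⟨hk, ha, h8⟩, h9⟩ := hp
    simp only [action, Action.run] at hrun
    split at hrun
    next hx =>
      simp only [Option.some.injEq, Prod.mk.injEq] at hrun
      obtain ⟨rfl, rfl⟩ := hrun
      obtain ⟨h10, h11⟩ := h4 hx
      have hne : newNode ≠ prev := by rintro rfl; exact ha (.inl h10)
      refine .relock hL hI hloc hx (.inl h10)
        (fun q _ => hI.not_holds_of_even (hx ▸ h3.1) q) (fun b hb => .inr ⟨hb, h3.1⟩)
        fun hE => ⟨v, curr, h1, h2.step hS hE, h10, by simpa using h11, h5.insert,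
          by rwa [hS.val_eq hE h5], ⟨hk, ?_, ?_⟩, ?_⟩
      · simpa [Snap.Published, hne] using ha
      · simpa [hne] using h8
      · simpa [hne] using h9
    next hx =>
      simp only [Option.some.injEq, Prod.mk.injEq] at hrun
      obtain ⟨rfl, rfl⟩ := hrun
      exact .goto hL hI hloc ⟨h1, h2⟩
  | insLink prev newNode =>
    simp only [action, Action.run, Option.some.injEq, Prod.mk.injEq] at hrun
    obtain ⟨rfl, rfl⟩ := hrun
    obtain ⟨v, curr, h1, h2, h3, h4, h5, h6, ⟨⟨k, hk, rfl⟩, ha, h8⟩, h9⟩ := hp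
    simp only at h3 h4 h6 h8 h9
    have hv : key v < (C.mem (C.mem prev).next).val := by rwa [h4]
    have hE := Evolves.link hs h3 h2.2 ha h8 (h9.trans h4.symm) hv
    refine .effect hL hI hloc (op := .insert v) (r := true) h1
      (t := ⟨Function.update C.mem prev { C.mem prev with next := .new p k }, insert (.new p k) K⟩)
      ⟨keys_link h3 ha h8, ?_⟩ hE
      (fun q hq => .link h3 (hI.odd_of_holds hloc rfl) (hI.not_holds hloc rfl q hq) hq)
      (fun k' hk' => ?_) (fun a h => ?_) (fun a h => .inl h) ⟨rfl, .inl (.inr h3)⟩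
    · simpa using hs.not_mem_keys_of_between h3 h2.2 hv
    · have h := hI.fresh p k' (by rwa [hloc])
      have hne : Ref.new p k' ≠ prev := by rintro rfl; exact h (.inl h3)
      have hkk : k' ≠ k := by rintro rfl; exact absurd hk (not_lt.2 hk')
      simpa [Snap.Published, hne, hkk] using h
    · obtain rfl : a = prev := h
      simpa using hI.odd_of_holds hloc (a := a) rfl
  | remVal v prev pVer curr =>
    simp only [action, Action.run, Option.some.injEq, Prod.mk.injEq] at hrun
    obtain ⟨rfl, rfl⟩ := hrun
    obtain ⟨h1, h2, h3, h4, h5, h6⟩ := hp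
    split
    next heq => exact .goto hL hI hloc ⟨h1, h2, h3, h4, h5.1, heq⟩
    next hne =>
      obtain ⟨u, hu, hv⟩ := h5.2 (lt_of_le_of_ne h6 (Ne.symm hne))
      exact .ret hL hI hloc h1 hu (trans_of_absent hv).2
  | remDel v prev pVer curr =>
    simp only [action, Action.run, Option.some.injEq, Prod.mk.injEq] at hrun
    obtain ⟨rfl, rfl⟩ := hrun
    obtain ⟨h1, h2, h3, h4, h5, h6⟩ := hp
    split
    next hd =>
      obtain ⟨u, hu, hv⟩ := hS.absent_of_deleted h5 h6 hd
      exact .ret hL hI hloc h1 hu (trans_of_absent hv).2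
    next hd =>
      exact .goto hL hI hloc ⟨h1, h2, h3, h5, h6, fun hv =>
        ⟨(h4 hv).1, (h4 hv).2, h2.2, h6, by simpa using hd⟩⟩
  | remLock v prev pVer curr =>
    obtain ⟨h1, h2, h3, h4, h5, h6⟩ := hp
    simp only [action, Action.run] at hrun
    split at hrun
    next hx =>
      simp only [Option.some.injEq, Prod.mk.injEq] at hrun
      obtain ⟨rfl, rfl⟩ := hrun
      have hR := h6 hx
      refine .relock hL hI hloc hx (.inl hR.mem)
        (fun q _ => hI.not_holds_of_even (hx ▸ h3.1) q) (fun b hb => .inr ⟨hb, h3.1⟩)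
        fun hE => ⟨v, h1, hR.mem, ?_, ?_, ?_, ?_⟩
      · simpa using hR.next
      · simpa using hR.lt
      · simpa [hR.ne.symm] using hR.val
      · simpa [hR.ne.symm] using hR.deleted
    next hx =>
      simp only [Option.some.injEq, Prod.mk.injEq] at hrun
      obtain ⟨rfl, rfl⟩ := hrun
      exact .goto hL hI hloc ⟨h1, h2⟩
  | remSpinVer prev curr =>
    simp only [action, Action.run, Option.some.injEq, Prod.mk.injEq] at hrun
    obtain ⟨rfl, rfl⟩ := hrun
    obtain ⟨v, h1, h2⟩ := hp
    exact .goto hL hI hloc ⟨v, h1, h2, even_version _⟩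
  | remSpinLock prev curr ver =>
    obtain ⟨v, h1, hR, h3⟩ := hp
    simp only [action, Action.run] at hrun
    split at hrun
    next hx =>
      simp only [Option.some.injEq, Prod.mk.injEq] at hrun
      obtain ⟨rfl, rfl⟩ := hrun
      refine .relock hL hI hloc hx (.inl (hR.mem_curr hs))
        (fun q _ => hI.not_holds_of_even (hx ▸ h3) q) (fun b hb => ?_)
        fun hE => ⟨v, h1, hR.mem, ?_, ?_, ?_, ?_⟩
      · rcases hb with rfl | rfl
        · exact .inl ⟨hR.ne, rfl⟩
        · exact .inr ⟨rfl, h3⟩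
      · simpa [hR.ne] using hR.next
      · simpa [hR.ne] using hR.lt
      · simpa using hR.val
      · simpa using hR.deleted
    next hx =>
      simp only [Option.some.injEq, Prod.mk.injEq] at hrun
      obtain ⟨rfl, rfl⟩ := hrun
      exact .goto hL hI hloc ⟨v, h1, hR⟩
  | remMark prev curr =>
    simp only [action, Action.run, Option.some.injEq, Prod.mk.injEq] at hrun
    obtain ⟨rfl, rfl⟩ := hrun
    obtain ⟨v, h1, hR⟩ := hp
    have hc := hR.mem_curr hs
    refine .effect hL hI hloc (op := .remove v) (r := true) h1
      (t := ⟨Function.update C.mem curr { C.mem curr with deleted := true }, K⟩)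
      ⟨keys_mark hs hc hR.val, ?_⟩ (.mark hs hc)
      (fun q hq => .mark hs hR (hI.odd_of_holds hloc (.inl rfl))
        (hI.not_holds hloc (.inl rfl) q hq))
      (fun k hk => ?_) (fun a h => ?_) (fun a h => .inl h) ⟨v, rfl, hR.mem, ?_, ?_, ?_, ?_⟩
    · simpa using ⟨curr, hc, hR.val, hR.deleted⟩
    · have h := hI.fresh p k (by rwa [hloc])
      have hne : Ref.new p k ≠ curr := by rintro rfl; exact h (.inl hc)
      simpa [Snap.Published, hne] using h
    · have := hI.odd_of_holds hloc h
      by_cases ha : a = curr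
      · subst ha; simpa using this
      · simpa [ha] using this
    · simpa [hR.ne] using hR.next
    · simpa [hR.ne] using hR.lt
    · simpa using hR.val
    · simp
  | remReadNext prev curr =>
    simp only [action, Action.run, Option.some.injEq, Prod.mk.injEq] at hrun
    obtain ⟨rfl, rfl⟩ := hrun
    obtain ⟨v, h1, hR⟩ := hp
    exact .goto hL hI hloc ⟨v, h1, hR, rfl⟩
  | remUnlink prev curr nxt =>
    simp only [action, Action.run, Option.some.injEq, Prod.mk.injEq] at hrun
    obtain ⟨rfl, rfl⟩ := hrun
    obtain ⟨v, h1, hR, rfl⟩ := hp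
    have hE := Evolves.unlink hs hR
    refine .silent hL hI hloc
      (t := ⟨Function.update C.mem prev { C.mem prev with next := (C.mem curr).next }, K \ {curr}⟩)
      (keys_unlink hR.deleted) hE
      (fun q hq => .unlink hR (hI.odd_of_holds hloc (.inl rfl)) (hI.odd_of_holds hloc (.inr rfl))
        (hI.not_holds hloc (.inl rfl) q hq) (hI.not_holds hloc (.inr rfl) q hq))
      (fun k hk => ?_) (fun a h => ?_) (fun a h => .inl h)
      ⟨h1, hE.published _ (.inl hR.mem), hE.published _ (.inl (hR.mem_curr hs)), hR.ne⟩
    · have h := hI.fresh p k (by rwa [hloc])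
      have hne : Ref.new p k ≠ prev := by rintro rfl; exact h (.inl hR.mem)
      have h' : Ref.new p k ∉ K ∧ (C.mem (Ref.new p k)).deleted = false := by
        simpa [Snap.Published] using h
      simp [Snap.Published, hne, h'.1, h'.2]
    · have := hI.odd_of_holds hloc h
      by_cases ha : a = prev
      · subst ha; simpa using this
      · simpa [ha] using this
  | remUnlockRead prev curr =>
    simp only [action, Action.run, Option.some.injEq, Prod.mk.injEq] at hrun
    obtain ⟨rfl, rfl⟩ := hrun
    obtain ⟨h1, h2, h3, h4⟩ := hp
    exact .goto hL hI hloc ⟨h1, h2, h3, h4, rfl⟩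
  | remUnlockCas prev curr x =>
    obtain ⟨h1, h2, h3, h4, h5⟩ := hp
    simp only [action, Action.run] at hrun
    rw [if_pos h5.symm] at hrun
    simp only [Option.some.injEq, Prod.mk.injEq] at hrun
    obtain ⟨rfl, rfl⟩ := hrun
    refine .relock hL hI hloc h5.symm h3 (hI.not_holds hloc (.inr rfl)) (fun b hb => ?_)
      fun hE => ⟨h1, hE.published _ h2⟩
    obtain rfl : b = prev := hb
    exact .inl ⟨h4, .inl rfl⟩
  | unlockRead prev =>
    simp only [action, Action.run, Option.some.injEq, Prod.mk.injEq] at hrun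
    obtain ⟨rfl, rfl⟩ := hrun
    obtain ⟨h1, h2⟩ := hp
    exact .goto hL hI hloc ⟨h1, h2, rfl⟩
  | unlockCas prev x =>
    obtain ⟨h1, h2, h3⟩ := hp
    simp only [action, Action.run] at hrun
    rw [if_pos h3.symm] at hrun
    simp only [Option.some.injEq, Prod.mk.injEq] at hrun
    obtain ⟨rfl, rfl⟩ := hrun
    exact .relock hL hI hloc h3.symm h2 (hI.not_holds hloc rfl) (fun _ h => h.elim)
      fun _ => h1

theorem sorted_initHeap : Snap.Sorted (⟨initHeap n, {.head, .tail}⟩ : Snap n) where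
  head_mem := by simp
  tail_mem := by simp
  val_head := rfl
  val_tail := rfl
  inj := by
    rintro a (rfl | rfl) b (rfl | rfl) h
    · rfl
    · exact absurd h bot_ne_top
    · exact absurd h top_ne_bot
    · rfl
  next_mem := by
    rintro a (rfl | rfl) ha
    · exact .inr rfl
    · exact absurd rfl ha
  lt_next := by
    rintro a (rfl | rfl) ha
    · exact bot_lt_top
    · exact absurd rfl ha
  next_le := by
    rintro a (rfl | rfl) ha b (rfl | rfl) hab
    · exact absurd hab (lt_irrefl _)
    · exact le_rfl
    · exact absurd rfl ha
    · exact absurd rfl ha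

theorem keys_initHeap : Snap.keys (⟨initHeap n, {.head, .tail}⟩ : Snap n) = ∅ := by
  ext v
  simp only [Snap.keys, Set.mem_ofPred_eq, Set.mem_empty_iff_false, iff_false]
  rintro ⟨a, rfl | rfl, h, -⟩
  · exact (bot_lt_key v).ne h
  · exact (key_lt_top v).ne' h

theorem Sim.init : Sim [] (initConfig n) := by
  refine ⟨{.head, .tail}, fun _ => {⟨initHeap n, {.head, .tail}⟩}, fun _ => .idle, ?_, ?_⟩
  · have : Snap.keys ⟨(initConfig n).mem, {.head, .tail}⟩ = setType.init := keys_initHeap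
    rw [this]
    exact .nil
  · exact {
      sorted := sorted_initHeap
      hindsight := fun _ => .singleton sorted_initHeap
      fresh := fun p k _ => by simp [Snap.Published, initConfig, initHeap]
      odd := fun p a h => h.elim
      excl := fun p q a h => h.elim
      pc := fun p => rfl }

theorem Sim.inv (h : Sim H C) (hp : (C.loc p).pc = .idle) (op : SetOp) :
    Sim (H ++ [.inv p op])
      { C with loc := Function.update C.loc p { C.loc p with pc := startPC op } } := by
  obtain ⟨K, S, st, hL, hI⟩ := h
  have hst : st p = .idle := by
    have := hI.pc p
    simp only [PCInv, hp] at this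
    exact this
  set s : Snap n := ⟨C.mem, K⟩ with hs
  have hS : Hindsight {s} s := .singleton hI.sorted
  refine ⟨K, Function.update S p {s}, _, (hL.inv hst op).mono fun q => ?_, ?_⟩
  · by_cases hq : q = p
    · subst hq
      rintro _ ⟨u, hu, rfl⟩
      obtain rfl : u = s := by simpa using hu
      rw [Function.update_self]
      exact rfl
    · simp only [Function.update_of_ne hq]; exact Set.Subset.rfl
  · have hnot : ∀ a, ¬ Holds (startPC op : PC n) a := by
      intro a
      cases op <;> exact id
    have hhead : Seen {s} .head := hS.seen_of_mem hI.sorted.head_mem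
    have hval : ∀ v, (s.mem .head).val < key v := fun v => by
      rw [hI.sorted.val_head]; exact bot_lt_key v
    have hreach : ∀ v, Reached {s} s v .head := fun v =>
      ⟨hhead, fun h => absurd h (not_lt.2 (hval v).le)⟩
    exact {
      sorted := hI.sorted
      hindsight := fun q => by
        by_cases hq : q = p
        · subst hq; simpa using hS
        · simpa [hq] using hI.hindsight q
      fresh := fun q k hk => hI.fresh q k <| by
        by_cases hq : q = p
        · subst hq; simpa using hk
        · simpa [hq] using hk
      odd := fun q a ha => by
        by_cases hq : q = p
        · subst hq
          simp only [Function.update_self] at ha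
          exact absurd ha (hnot a)
        · simp only [Function.update_of_ne hq] at ha
          exact hI.odd q a ha
      excl := fun q r a hq hr => by
        by_cases hqp : q = p
        · subst hqp
          simp only [Function.update_self] at hq
          exact absurd hq (hnot a)
        by_cases hrp : r = p
        · subst hrp
          simp only [Function.update_self] at hr
          exact absurd hr (hnot a)
        simp only [Function.update_of_ne hqp, Function.update_of_ne hrp] at hq hr
        exact hI.excl q r a hq hr
      pc := fun q => by
        by_cases hq : q = p
        · subst hq
          simp only [Function.update_self]
          cases op with
          | insert v => exact ⟨rfl, ⟨hhead, hval v⟩, hreach v⟩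
          | remove v => exact ⟨rfl, ⟨hhead, hval v⟩, hreach v⟩
          | contains v => exact ⟨rfl, hreach v⟩
        · simp only [Function.update_of_ne hq]
          exact hI.pc q }

theorem Sim.res (h : Sim H C) {r : Bool} (hp : (C.loc p).pc = .ret r) :
    Sim (H ++ [.res p r])
      { C with loc := Function.update C.loc p { C.loc p with pc := .idle } } := by
  obtain ⟨K, S, st, hL, hI⟩ := h
  have hst : st p = .done r := by
    have := hI.pc p
    simp only [PCInv, hp] at this
    exact this
  have hloc : C.loc p = ⟨.ret r, (C.loc p).allocs⟩ := by rw [← hp]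
  exact ⟨K, S, _, hL.res hst, hI.local hloc .idle (fun _ h => h.elim) rfl⟩

theorem Reaches.sim {α : List (Event n)} (h : Reaches α C) : Sim (history α) C := by
  induction h with
  | nil => exact Sim.init
  | snoc _ hstep ih =>
    rw [history, List.filterMap_append]
    cases hstep with
    | inv p op hp => exact ih.inv hp op
    | prim p M l hrun => simpa [history] using ih.prim hrun
    | res p r hp => exact ih.res hp

end Simulation

end VersionedList

theorem theorem1 (n : ℕ) (α : List (VersionedList.Event n))
    (hα : VersionedList.IsExecution α) :
    VersionedList.Linearizable VersionedList.setType (VersionedList.history α) := by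
  obtain ⟨C, hC⟩ := hα
  obtain ⟨K, S, st, hL, -⟩ := hC.sim
  exact hL.linearizable
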